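/- Let $l>0$. For real coefficients $a_1,\dots,a_8\ge 0$ consider the eigenvalue problem on $[0,l]$ $$y^{(4)}=s^2y,$$ $$-a_1y(0)+a_4y'''(0)=0,\quad -a_2y'(0)+a_3y''(0)=0,\quad a_5y(l)+a_8y'''(l)=0,\quad a_6y'(l)+a_7y''(l)=0,$$ where $s\in\mathbb C$ and $y$ is complex-valued. The multiplicity of $s$ is the dimension of the space of solutions $y$ of this problem; $s$ is an eigenvalue if it is positive ($s=0$ is allowed). Let $$A=\begin{pmatrix} a_1&0&0&a_4&0&0&0&0\\ 0&a_2&a_3&0&0&0&0&0\\ 0&0&0&0&a_5&0&0&a_8\\ 0&0&0&0&0&a_6&a_7&0\end{pmatrix},$$ let $\widetilde A$ be the corresponding matrix of a second problem of this kind, with the same $l$ and with coefficients $\widetilde a_1,\dots,\widetilde a_8\ge 0$, and let $$\widetilde A^*=\begin{pmatrix} \widetilde a_5&0&0&\widetilde a_8&0&0&0&0\\ 0&\widetilde a_6&\widetilde a_7&0&0&0&0&0\\ 0&0&0&0&\widetilde a_1&0&0&\widetilde a_4\\ 0&0&0&0&0&\widetilde a_2&\widetilde a_3&0\end{pmatrix}.$$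 Call two $4\times 8$ matrices linearly equivalent if one is obtained from the other by multiplication on the left by an invertible $4\times4$ matrix. Theorem 1 (on the duality of the solution of the inverse problem). Suppose $\operatorname{rank}A=\operatorname{rank}\widetilde A=4$. If the two problems have the same eigenvalues $s\in\mathbb C$, counted with multiplicity (the eigenvalue $0$ included), then $A$ is linearly equivalent to $\widetilde A$ or to $\widetilde A^*$. -/

import Mathlib

/-- The coefficients of the separated boundary conditions
`-a₁ y(0) + a₄ y'''(0) = 0`, `-a₂ y'(0) + a₃ y''(0) = 0`,
`a₅ y(l) + a₈ y'''(l) = 0`, `a₆ y'(l) + a₇ y''(l) = 0`. -/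
structure RodBC where
  a₁ : ℝ
  a₂ : ℝ
  a₃ : ℝ
  a₄ : ℝ
  a₅ : ℝ
  a₆ : ℝ
  a₇ : ℝ
  a₈ : ℝ

namespace RodBC

/-- All coefficients are nonnegative. -/
def Nonneg (a : RodBC) : Prop :=
  0 ≤ a.a₁ ∧ 0 ≤ a.a₂ ∧ 0 ≤ a.a₃ ∧ 0 ≤ a.a₄ ∧ 0 ≤ a.a₅ ∧ 0 ≤ a.a₆ ∧ 0 ≤ a.a₇ ∧ 0 ≤ a.a₈

/-- The `4 × 8` coefficient matrix `A`. -/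
def matrix (a : RodBC) : Matrix (Fin 4) (Fin 8) ℝ :=
  !![a.a₁, 0, 0, a.a₄, 0, 0, 0, 0;
     0, a.a₂, a.a₃, 0, 0, 0, 0, 0;
     0, 0, 0, 0, a.a₅, 0, 0, a.a₈;
     0, 0, 0, 0, 0, a.a₆, a.a₇, 0]

/-- Interchange of the two ends of the rod: `a.swap.matrix` is the matrix `A*`. -/
def swap (a : RodBC) : RodBC where
  a₁ := a.a₅
  a₂ := a.a₆
  a₃ := a.a₇
  a₄ := a.a₈
  a₅ := a.a₁
  a₆ := a.a₂
  a₇ := a.a₃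
  a₈ := a.a₄

/-- `y` is a classical (`C⁴` up to the ends) solution on `[0, l]` of `y'''' = s² y` satisfying the
four boundary conditions; derivatives are taken within `[0, l]`. -/
def IsSolution (a : RodBC) (l : ℝ) (s : ℂ) (y : ℝ → ℂ) : Prop :=
  ContDiffOn ℝ 4 y (Set.Icc 0 l) ∧
  (∀ x ∈ Set.Icc 0 l, iteratedDerivWithin 4 y (Set.Icc 0 l) x = s ^ 2 * y x) ∧
  -(a.a₁ : ℂ) * y 0 + (a.a₄ : ℂ) * iteratedDerivWithin 3 y (Set.Icc 0 l) 0 = 0 ∧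
  -(a.a₂ : ℂ) * iteratedDerivWithin 1 y (Set.Icc 0 l) 0
    + (a.a₃ : ℂ) * iteratedDerivWithin 2 y (Set.Icc 0 l) 0 = 0 ∧
  (a.a₅ : ℂ) * y l + (a.a₈ : ℂ) * iteratedDerivWithin 3 y (Set.Icc 0 l) l = 0 ∧
  (a.a₆ : ℂ) * iteratedDerivWithin 1 y (Set.Icc 0 l) l
    + (a.a₇ : ℂ) * iteratedDerivWithin 2 y (Set.Icc 0 l) l = 0

/-- The space of solutions of the boundary value problem for the parameter `s`. A function on
`[0, l]` is represented by its extension by zero to `ℝ`. -/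
def eigenspace (a : RodBC) (l : ℝ) (hl : 0 < l) (s : ℂ) : Submodule ℂ (ℝ → ℂ) where
  carrier := {y | a.IsSolution l s y ∧ ∀ x, x ∉ Set.Icc 0 l → y x = 0}
  zero_mem' := by
    refine ⟨⟨contDiffOn_const, ?_, ?_, ?_, ?_, ?_⟩, fun _ _ => rfl⟩ <;> simp
  add_mem' := by
    rintro y z ⟨⟨hy, ey, y1, y2, y3, y4⟩, hy0⟩ ⟨⟨hz, ez, z1, z2, z3, z4⟩, hz0⟩
    have h0 : (0 : ℝ) ∈ Set.Icc 0 l := ⟨le_rfl, hl.le⟩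
    have h1 : l ∈ Set.Icc 0 l := ⟨hl.le, le_rfl⟩
    have key : ∀ n : ℕ, n ≤ 4 → ∀ x ∈ Set.Icc 0 l,
        iteratedDerivWithin n (y + z) (Set.Icc 0 l) x =
          iteratedDerivWithin n y (Set.Icc 0 l) x + iteratedDerivWithin n z (Set.Icc 0 l) x := by
      intro n hn x hx
      have hn' : (n : WithTop ℕ∞) ≤ 4 := by exact_mod_cast hn
      exact iteratedDerivWithin_add hx (uniqueDiffOn_Icc hl)
        ((hy x hx).of_le hn') ((hz x hx).of_le hn')
    refine ⟨⟨hy.add hz, fun x hx => ?_, ?_, ?_, ?_, ?_⟩, fun x hx => ?_⟩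
    · rw [key 4 le_rfl x hx, ey x hx, ez x hx, Pi.add_apply]; ring
    · rw [key 3 (by norm_num) 0 h0, Pi.add_apply]; linear_combination y1 + z1
    · rw [key 1 (by norm_num) 0 h0, key 2 (by norm_num) 0 h0]; linear_combination y2 + z2
    · rw [key 3 (by norm_num) l h1, Pi.add_apply]; linear_combination y3 + z3
    · rw [key 1 (by norm_num) l h1, key 2 (by norm_num) l h1]; linear_combination y4 + z4
    · rw [Pi.add_apply, hy0 x hx, hz0 x hx, add_zero]
  smul_mem' := by
    rintro c y ⟨⟨hy, ey, y1, y2, y3, y4⟩, hy0⟩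
    have h0 : (0 : ℝ) ∈ Set.Icc 0 l := ⟨le_rfl, hl.le⟩
    have h1 : l ∈ Set.Icc 0 l := ⟨hl.le, le_rfl⟩
    have key : ∀ n : ℕ, n ≤ 4 → ∀ x ∈ Set.Icc 0 l,
        iteratedDerivWithin n (c • y) (Set.Icc 0 l) x =
          c * iteratedDerivWithin n y (Set.Icc 0 l) x := by
      intro n hn x hx
      have hn' : (n : WithTop ℕ∞) ≤ 4 := by exact_mod_cast hn
      exact iteratedDerivWithin_const_smul hx (uniqueDiffOn_Icc hl) c ((hy x hx).of_le hn')
    refine ⟨⟨hy.const_smul c, fun x hx => ?_, ?_, ?_, ?_, ?_⟩, fun x hx => ?_⟩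
    · rw [key 4 le_rfl x hx, ey x hx, Pi.smul_apply, smul_eq_mul]; ring
    · rw [key 3 (by norm_num) 0 h0, Pi.smul_apply, smul_eq_mul]; linear_combination c * y1
    · rw [key 1 (by norm_num) 0 h0, key 2 (by norm_num) 0 h0]; linear_combination c * y2
    · rw [key 3 (by norm_num) l h1, Pi.smul_apply, smul_eq_mul]; linear_combination c * y3
    · rw [key 1 (by norm_num) l h1, key 2 (by norm_num) l h1]; linear_combination c * y4
    · rw [Pi.smul_apply, hy0 x hx, smul_zero]

/-- The multiplicity of `s` as an eigenvalue: the number of linearly independent eigenfunctions.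
It is positive exactly when `s` is an eigenvalue. -/
noncomputable def multiplicity (a : RodBC) (l : ℝ) (hl : 0 < l) (s : ℂ) : ℕ :=
  Module.finrank ℂ (a.eigenspace l hl s)

end RodBC

/-- Two `4 × 8` matrices are linearly equivalent if their rows are related by an invertible linear
transformation, i.e. they differ by an invertible left factor. -/
def LinearlyEquivalent (A B : Matrix (Fin 4) (Fin 8) ℝ) : Prop :=
  ∃ S : Matrix (Fin 4) (Fin 4) ℝ, IsUnit S ∧ A = S * B

/-! The pairs `(a₁ : a₄)`, `(a₅ : a₈)` multiply to a binary quadratic form with coefficients `e₀,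
e₁, e₂`, and the pairs `(a₂ : a₃)`, `(a₆ : a₇)` to one with coefficients `f₀, f₁, f₂`. For `s = z ^
2` with `z > 0`, the number `s` is an eigenvalue iff a combination of `cos cosh ± 1`, `cos sinh ±
sin cosh` and `sin sinh` at `l z` vanishes. Its coefficients are, up to powers of `z`, the
polynomials `pE, pD, pU, pV, pW` in `z ^ 4`, built from the products `eᵢ fⱼ` and the number `m`.

Two isospectral problems share arbitrarily large roots of their two equations
(`frequently_multiplicity_ne_zero`). Eliminating `cos` and `sin` leaves a polynomial in `z` and `exp
(-2 l z)` with arbitrarily large zeros, hence the zero polynomial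
(`frequency_equation_elimination`). Therefore the coefficient vectors of the two problems are
proportional (`coefficients_proportional`).

If `e₁ f₁ ≠ 0`, the ratio is a constant, and the products `eᵢ fⱼ` determine both forms up to scale
(`cross_of_ne_zero`). If `e₁ f₁ = 0`, the ratio may involve powers of `z`: clamped-clamped and
free-free rods have the same positive eigenvalues. The eigenvalue `0` then decides
(`cross_of_eq_zero`).

Each form determines its two linear factors up to order. Equal orders give the matrix of the second
problem or its reflection. Unequal orders are compatible with `m` only if one form has proportional
factors, and then the order is immaterial (`linearlyEquivalent_of_invariants`). -/

/-! ### Recovering the boundary conditions from the two quadratic forms and `m` -/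

/-- The row vectors `(x, y)` and `(x', y')` differ by a nonzero factor. -/
def RowParallel (x y x' y' : ℝ) : Prop :=
  ∃ k : ℝ, k ≠ 0 ∧ x = k * x' ∧ y = k * y'

theorem RowParallel.of_cross {x y x' y' : ℝ} (h : x * y' = y * x') (hxy : x ≠ 0 ∨ y ≠ 0)
    (hxy' : x' ≠ 0 ∨ y' ≠ 0) : RowParallel x y x' y' := by
  by_cases hx' : x' = 0
  · subst hx'
    have hy' : y' ≠ 0 := by simpa using hxy'
    have hx : x = 0 := by simpa [hy'] using h
    have hy : y ≠ 0 := by simpa [hx] using hxy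
    exact ⟨y / y', div_ne_zero hy hy', by simp [hx], by field_simp⟩
  · have hx : x ≠ 0 := by
      rintro rfl
      have : y = 0 := by simpa [hx'] using h.symm
      simp [this] at hxy
    exact ⟨x / x', div_ne_zero hx hx', by field_simp, by field_simp; linarith⟩

theorem RowParallel.trans {x y x' y' x'' y'' : ℝ} (h : RowParallel x y x' y')
    (h' : RowParallel x' y' x'' y'') : RowParallel x y x'' y'' := by
  obtain ⟨k, hk, rfl, rfl⟩ := h
  obtain ⟨k', hk', rfl, rfl⟩ := h'
  exact ⟨k * k', mul_ne_zero hk hk', by ring, by ring⟩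

namespace RodBC

/-- Each of the four boundary conditions is nontrivial. -/
def Nondegenerate (a : RodBC) : Prop :=
  (a.a₁ ≠ 0 ∨ a.a₄ ≠ 0) ∧ (a.a₂ ≠ 0 ∨ a.a₃ ≠ 0) ∧ (a.a₅ ≠ 0 ∨ a.a₈ ≠ 0) ∧
    (a.a₆ ≠ 0 ∨ a.a₇ ≠ 0)

theorem nondegenerate_of_rank (a : RodBC) (h : a.matrix.rank = 4) : a.Nondegenerate := by
  have hli : LinearIndependent ℝ a.matrix.row := by
    rw [linearIndependent_iff_card_eq_finrank_span, Set.finrank,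
      ← Matrix.rank_eq_finrank_span_row, h, Fintype.card_fin]
  have hne := fun i => hli.ne_zero i
  refine ⟨?_, ?_, ?_, ?_⟩ <;> by_contra! hc
  · exact hne 0 (by ext j; fin_cases j <;> simp [matrix, hc.1, hc.2])
  · exact hne 1 (by ext j; fin_cases j <;> simp [matrix, hc.1, hc.2])
  · exact hne 2 (by ext j; fin_cases j <;> simp [matrix, hc.1, hc.2])
  · exact hne 3 (by ext j; fin_cases j <;> simp [matrix, hc.1, hc.2])

theorem linearlyEquivalent_of_rowParallel (a b : RodBC)
    (h₁ : RowParallel a.a₁ a.a₄ b.a₁ b.a₄) (h₂ : RowParallel a.a₂ a.a₃ b.a₂ b.a₃)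
    (h₃ : RowParallel a.a₅ a.a₈ b.a₅ b.a₈) (h₄ : RowParallel a.a₆ a.a₇ b.a₆ b.a₇) :
    LinearlyEquivalent a.matrix b.matrix := by
  obtain ⟨k₁, hk₁, e₁, e₁'⟩ := h₁
  obtain ⟨k₂, hk₂, e₂, e₂'⟩ := h₂
  obtain ⟨k₃, hk₃, e₃, e₃'⟩ := h₃
  obtain ⟨k₄, hk₄, e₄, e₄'⟩ := h₄
  refine ⟨Matrix.diagonal ![k₁, k₂, k₃, k₄], ?_, ?_⟩
  · rw [Matrix.isUnit_iff_isUnit_det, Matrix.det_diagonal, isUnit_iff_ne_zero, Fin.prod_univ_four]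
    simp [hk₁, hk₂, hk₃, hk₄]
  · ext i j
    rw [Matrix.diagonal_mul]
    fin_cases i <;> fin_cases j <;> simp [matrix, e₁, e₁', e₂, e₂', e₃, e₃', e₄, e₄']

/-- The leading coefficient of the product of the forms `(a₁ : a₄)` and `(a₅ : a₈)`. -/
def e₀ (a : RodBC) : ℝ := a.a₄ * a.a₈

/-- The mixed coefficient of the product of the forms `(a₁ : a₄)` and `(a₅ : a₈)`. -/
def e₁ (a : RodBC) : ℝ := a.a₄ * a.a₅ + a.a₁ * a.a₈

/-- The trailing coefficient of the product of the forms `(a₁ : a₄)` and `(a₅ : a₈)`. -/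
def e₂ (a : RodBC) : ℝ := a.a₁ * a.a₅

/-- The leading coefficient of the product of the forms `(a₂ : a₃)` and `(a₆ : a₇)`. -/
def f₀ (a : RodBC) : ℝ := a.a₃ * a.a₇

/-- The mixed coefficient of the product of the forms `(a₂ : a₃)` and `(a₆ : a₇)`. -/
def f₁ (a : RodBC) : ℝ := a.a₃ * a.a₆ + a.a₂ * a.a₇

/-- The trailing coefficient of the product of the forms `(a₂ : a₃)` and `(a₆ : a₇)`. -/
def f₂ (a : RodBC) : ℝ := a.a₂ * a.a₆

/-- The part of `e₁ * f₁` that records how the two pairs are matched at the ends. -/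
def m (a : RodBC) : ℝ := a.a₂ * a.a₄ * a.a₅ * a.a₇ + a.a₁ * a.a₃ * a.a₆ * a.a₈

/-- Two binary quadratic forms given as products of linear forms and having proportional
coefficients have the same linear factors up to order. -/
theorem rowParallel_of_products {p q r s p' q' r' s' : ℝ}
    (h₁ : p ≠ 0 ∨ q ≠ 0) (h₂ : r ≠ 0 ∨ s ≠ 0) (h₁' : p' ≠ 0 ∨ q' ≠ 0) (h₂' : r' ≠ 0 ∨ s' ≠ 0)
    (c₀₁ : q * s * (q' * r' + p' * s') = (q * r + p * s) * (q' * s'))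
    (c₀₂ : q * s * (p' * r') = p * r * (q' * s'))
    (c₁₂ : (q * r + p * s) * (p' * r') = p * r * (q' * r' + p' * s')) :
    RowParallel p q p' q' ∧ RowParallel r s r' s' ∨
      RowParallel p q r' s' ∧ RowParallel r s p' q' := by
  -- This is the form `(q X + p Y)(s X + r Y)` at the zero `(p', -q')` of the primed factor `q' X +
  -- p' Y`. It vanishes because the primed form does and the coefficients are proportional; which
  -- relation can be divided out depends on which primed coefficient is nonzero.
  have hprod : (q * p' - p * q') * (s * p' - r * q') = 0 := by
    by_cases b₀ : q' * s' = 0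
    · by_cases b₂ : p' * r' = 0
      · have b₁ : q' * r' + p' * s' ≠ 0 := by
          rcases mul_eq_zero.1 b₀ with h | h <;> rcases mul_eq_zero.1 b₂ with h' | h' <;> simp_all
        apply mul_left_cancel₀ b₁
        linear_combination p' ^ 2 * c₀₁ - q' ^ 2 * c₁₂
      · apply mul_left_cancel₀ b₂
        linear_combination p' ^ 2 * c₀₂ - p' * q' * c₁₂
    · apply mul_left_cancel₀ b₀
      linear_combination p' * q' * c₀₁ - q' ^ 2 * c₀₂
  rcases mul_eq_zero.1 hprod with h | h
  · obtain ⟨k, hk, rfl, rfl⟩ : RowParallel p q p' q' := .of_cross (by linarith) h₁ h₁'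
    refine .inl ⟨⟨k, hk, rfl, rfl⟩, .of_cross ?_ h₂ h₂'⟩
    rcases h₁' with h' | h'
    · apply mul_left_cancel₀ (mul_ne_zero hk (mul_ne_zero h' h'))
      linear_combination -c₁₂
    · apply mul_left_cancel₀ (mul_ne_zero hk (mul_ne_zero h' h'))
      linear_combination -c₀₁
  · obtain ⟨k, hk, rfl, rfl⟩ : RowParallel r s p' q' := .of_cross (by linarith) h₂ h₁'
    refine .inr ⟨.of_cross ?_ h₁ h₂', ⟨k, hk, rfl, rfl⟩⟩
    rcases h₁' with h' | h'
    · apply mul_left_cancel₀ (mul_ne_zero hk (mul_ne_zero h' h'))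
      linear_combination -c₁₂
    · apply mul_left_cancel₀ (mul_ne_zero hk (mul_ne_zero h' h'))
      linear_combination -c₀₁

/-- The two possible matchings differ by `(a₁ a₈ - a₄ a₅)(a₂ a₇ - a₃ a₆)`. If instead `e₁ f₁ = 0`,
nonnegativity kills both summands of `e₁` or of `f₁`, and the same alternative follows. -/
theorem cross_eq_of_matching_eq (b : RodBC) (hb : b.Nonneg)
    (h : (b.a₃ * b.a₄ * b.a₅ * b.a₆ + b.a₁ * b.a₂ * b.a₇ * b.a₈) * (b.e₁ * b.f₁) =
      b.m * (b.e₁ * b.f₁)) :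
    b.a₁ * b.a₈ = b.a₄ * b.a₅ ∨ b.a₂ * b.a₇ = b.a₃ * b.a₆ := by
  obtain ⟨p₁, p₂, p₃, p₄, p₅, p₆, p₇, p₈⟩ := hb
  have h' : (b.a₁ * b.a₈ - b.a₄ * b.a₅) * (b.a₂ * b.a₇ - b.a₃ * b.a₆) * (b.e₁ * b.f₁) = 0 := by
    unfold m at h; linear_combination h
  rcases mul_eq_zero.1 h' with h' | h'
  · rcases mul_eq_zero.1 h' with h' | h'
    · exact .inl (sub_eq_zero.1 h')
    · exact .inr (sub_eq_zero.1 h')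
  · rcases mul_eq_zero.1 h' with h' | h'
    · have q₁ := mul_nonneg p₄ p₅
      have q₂ := mul_nonneg p₁ p₈
      unfold e₁ at h'
      exact .inl (by linarith)
    · have q₁ := mul_nonneg p₃ p₆
      have q₂ := mul_nonneg p₂ p₇
      unfold f₁ at h'
      exact .inr (by linarith)

theorem linearlyEquivalent_of_invariants (a b : RodBC) (hb : b.Nonneg)
    (ha' : a.Nondegenerate) (hb' : b.Nondegenerate)
    (he₀₁ : a.e₀ * b.e₁ = a.e₁ * b.e₀) (he₀₂ : a.e₀ * b.e₂ = a.e₂ * b.e₀)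
    (he₁₂ : a.e₁ * b.e₂ = a.e₂ * b.e₁)
    (hf₀₁ : a.f₀ * b.f₁ = a.f₁ * b.f₀) (hf₀₂ : a.f₀ * b.f₂ = a.f₂ * b.f₀)
    (hf₁₂ : a.f₁ * b.f₂ = a.f₂ * b.f₁)
    (hm : a.m * (b.e₁ * b.f₁) = b.m * (a.e₁ * a.f₁)) :
    LinearlyEquivalent a.matrix b.matrix ∨ LinearlyEquivalent a.matrix b.swap.matrix := by
  obtain ⟨n₁, n₂, n₃, n₄⟩ := ha'
  obtain ⟨n₁', n₂', n₃', n₄'⟩ := hb'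
  have hE := rowParallel_of_products n₁ n₃ n₁' n₃' he₀₁ he₀₂ he₁₂
  have hF := rowParallel_of_products n₂ n₄ n₂' n₄' hf₀₁ hf₀₂ hf₁₂
  rcases hE with ⟨E₁, E₂⟩ | ⟨E₁, E₂⟩ <;> rcases hF with ⟨F₁, F₂⟩ | ⟨F₁, F₂⟩
  · exact .inl (linearlyEquivalent_of_rowParallel a b E₁ F₁ E₂ F₂)
  -- One form is matched in order and the other reversed, so rescaling turns `hm` into equality of
  -- the two matchings of `b`. A form with proportional factors can then be reversed at will.
  · have hc : b.a₁ * b.a₈ = b.a₄ * b.a₅ ∨ b.a₂ * b.a₇ = b.a₃ * b.a₆ := by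
      obtain ⟨k₁, hk₁, s₁, s₄⟩ := E₁
      obtain ⟨k₂, hk₂, s₅, s₈⟩ := E₂
      obtain ⟨k₃, hk₃, s₂, s₃⟩ := F₁
      obtain ⟨k₄, hk₄, s₆, s₇⟩ := F₂
      apply cross_eq_of_matching_eq b hb
      apply mul_left_cancel₀ (mul_ne_zero (mul_ne_zero hk₁ hk₂) (mul_ne_zero hk₃ hk₄))
      unfold m e₁ f₁ at *
      rw [s₁, s₂, s₃, s₄, s₅, s₆, s₇, s₈] at hm
      linear_combination hm
    rcases hc with hc | hc
    · have hp : RowParallel b.a₁ b.a₄ b.a₅ b.a₈ := .of_cross hc n₁' n₃'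
      have hp' : RowParallel b.a₅ b.a₈ b.a₁ b.a₄ := .of_cross (by linarith) n₃' n₁'
      exact .inr (linearlyEquivalent_of_rowParallel a b.swap (E₁.trans hp) F₁ (E₂.trans hp') F₂)
    · have hp : RowParallel b.a₂ b.a₃ b.a₆ b.a₇ := .of_cross hc n₂' n₄'
      have hp' : RowParallel b.a₆ b.a₇ b.a₂ b.a₃ := .of_cross (by linarith) n₄' n₂'
      exact .inl (linearlyEquivalent_of_rowParallel a b E₁ (F₁.trans hp') E₂ (F₂.trans hp))
  · have hc : b.a₁ * b.a₈ = b.a₄ * b.a₅ ∨ b.a₂ * b.a₇ = b.a₃ * b.a₆ := by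
      obtain ⟨k₁, hk₁, s₁, s₄⟩ := E₁
      obtain ⟨k₂, hk₂, s₅, s₈⟩ := E₂
      obtain ⟨k₃, hk₃, s₂, s₃⟩ := F₁
      obtain ⟨k₄, hk₄, s₆, s₇⟩ := F₂
      apply cross_eq_of_matching_eq b hb
      apply mul_left_cancel₀ (mul_ne_zero (mul_ne_zero hk₁ hk₂) (mul_ne_zero hk₃ hk₄))
      unfold m e₁ f₁ at *
      rw [s₁, s₂, s₃, s₄, s₅, s₆, s₇, s₈] at hm
      linear_combination hm
    rcases hc with hc | hc
    · have hp : RowParallel b.a₁ b.a₄ b.a₅ b.a₈ := .of_cross hc n₁' n₃'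
      have hp' : RowParallel b.a₅ b.a₈ b.a₁ b.a₄ := .of_cross (by linarith) n₃' n₁'
      exact .inl (linearlyEquivalent_of_rowParallel a b (E₁.trans hp') F₁ (E₂.trans hp) F₂)
    · have hp : RowParallel b.a₂ b.a₃ b.a₆ b.a₇ := .of_cross hc n₂' n₄'
      have hp' : RowParallel b.a₆ b.a₇ b.a₂ b.a₃ := .of_cross (by linarith) n₄' n₂'
      exact .inr (linearlyEquivalent_of_rowParallel a b.swap E₁ (F₁.trans hp) E₂ (F₂.trans hp'))
  · exact .inr (linearlyEquivalent_of_rowParallel a b.swap E₁ F₁ E₂ F₂)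
end RodBC

/-! ### Comparing the forms from proportional products -/

/-- Comparison of the invariants in the case `e₁ * f₁ ≠ 0`. -/
theorem cross_of_ne_zero {e₀ e₁ e₂ f₀ f₁ f₂ g₀ g₁ g₂ h₀ h₁ h₂ : ℝ}
    (hg : g₀ ≠ 0 ∨ g₁ ≠ 0 ∨ g₂ ≠ 0) (hh : h₀ ≠ 0 ∨ h₁ ≠ 0 ∨ h₂ ≠ 0) (hef : e₁ * f₁ ≠ 0)
    (h00 : e₁ * f₁ * (g₀ * h₀) = g₁ * h₁ * (e₀ * f₀))
    (h22 : e₁ * f₁ * (g₂ * h₂) = g₁ * h₁ * (e₂ * f₂))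
    (h10 : e₁ * f₁ * (g₁ * h₀) = g₁ * h₁ * (e₁ * f₀))
    (h21 : e₁ * f₁ * (g₂ * h₁) = g₁ * h₁ * (e₂ * f₁))
    (h01 : e₁ * f₁ * (g₀ * h₁) = g₁ * h₁ * (e₀ * f₁))
    (h12 : e₁ * f₁ * (g₁ * h₂) = g₁ * h₁ * (e₁ * f₂))
    (h02 : e₁ * f₁ * (g₀ * h₂) = g₁ * h₁ * (e₀ * f₂))
    (h20 : e₁ * f₁ * (g₂ * h₀) = g₁ * h₁ * (e₂ * f₀)) :
    (e₀ * g₁ = e₁ * g₀ ∧ e₀ * g₂ = e₂ * g₀ ∧ e₁ * g₂ = e₂ * g₁) ∧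
      (f₀ * h₁ = f₁ * h₀ ∧ f₀ * h₂ = f₂ * h₀ ∧ f₁ * h₂ = f₂ * h₁) := by
  have he : e₁ ≠ 0 := left_ne_zero_of_mul hef
  have hf : f₁ ≠ 0 := right_ne_zero_of_mul hef
  -- Otherwise every product `gᵢ hⱼ` vanishes, although neither form is zero.
  have hgh : g₁ * h₁ ≠ 0 := by
    intro h
    rw [h, zero_mul, mul_eq_zero_iff_left hef] at h00 h22 h10 h21 h01 h12 h02 h20
    simp only [mul_eq_zero] at *
    grind
  have hg1 : g₁ ≠ 0 := left_ne_zero_of_mul hgh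
  have hh1 : h₁ ≠ 0 := right_ne_zero_of_mul hgh
  have k1 : e₀ * g₁ = e₁ * g₀ := by
    apply mul_left_cancel₀ (mul_ne_zero hf hh1); linear_combination -h01
  have k2 : e₁ * g₂ = e₂ * g₁ := by
    apply mul_left_cancel₀ (mul_ne_zero hf hh1); linear_combination h21
  have k3 : f₀ * h₁ = f₁ * h₀ := by
    apply mul_left_cancel₀ (mul_ne_zero he hg1); linear_combination -h10
  have k4 : f₁ * h₂ = f₂ * h₁ := by
    apply mul_left_cancel₀ (mul_ne_zero he hg1); linear_combination h12
  refine ⟨⟨k1, ?_, k2⟩, k3, ?_, k4⟩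
  · apply mul_left_cancel₀ he; linear_combination e₀ * k2 + e₂ * k1
  · apply mul_left_cancel₀ hf; linear_combination f₀ * k4 + f₂ * k3

theorem cubic_coeffs_eq_zero (A B C D : ℝ)
    (h : ∀ t : ℝ, A * t ^ 3 + B * t ^ 2 + C * t + D = 0) : A = 0 ∧ B = 0 ∧ C = 0 ∧ D = 0 := by
  have t0 := h 0
  have t1 := h 1
  have t2 := h (-1)
  have t3 := h 2
  refine ⟨?_, ?_, ?_, ?_⟩ <;> linarith

/-- With `x = f`, this is minus the coefficient of `e₂` in the criterion for the eigenvalue `0`; all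
its terms are nonnegative. -/
theorem rigid_sum_ne_zero {l x₀ x₁ x₂ : ℝ} (hl : 0 < l) (p₀ : 0 ≤ x₀) (p₁ : 0 ≤ x₁) (p₂ : 0 ≤ x₂)
    (h : x₀ ≠ 0 ∨ x₁ ≠ 0 ∨ x₂ ≠ 0) :
    l ^ 3 / 3 * x₁ + l ^ 2 * x₀ + l ^ 4 / 12 * x₂ ≠ 0 := by
  rcases h with h | h | h
  · have := lt_of_le_of_ne' p₀ h; positivity
  · have := lt_of_le_of_ne' p₁ h; positivity
  · have := lt_of_le_of_ne' p₂ h; positivity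

/-- One of the two forms is reduced to a single extreme coefficient, which leaves four shapes per
problem. -/
theorem degenerate_cases {x₀ x₁ x₂ y₀ y₁ y₂ : ℝ} (h : x₁ * y₁ = 0)
    (hx : x₁ = 0 → x₀ = 0 ∨ x₂ = 0) (hy : y₁ = 0 → y₀ = 0 ∨ y₂ = 0) :
    (x₁ = 0 ∧ x₂ = 0) ∨ (x₀ = 0 ∧ x₁ = 0) ∨ (y₁ = 0 ∧ y₂ = 0) ∨ (y₀ = 0 ∧ y₁ = 0) := by
  rcases mul_eq_zero.1 h with h | h
  · have := hx h; tauto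
  · have := hy h; tauto

set_option maxHeartbeats 2000000 in
/-- Comparison of the invariants in the degenerate case `e₁ * f₁ = g₁ * h₁ = 0`. -/
theorem cross_of_eq_zero {l e₀ e₁ e₂ f₀ f₁ f₂ g₀ g₁ g₂ h₀ h₁ h₂ : ℝ} (hl : 0 < l)
    (hf₀ : 0 ≤ f₀) (hf₁ : 0 ≤ f₁) (hf₂ : 0 ≤ f₂)
    (hh₀ : 0 ≤ h₀) (hh₁ : 0 ≤ h₁) (hh₂ : 0 ≤ h₂)
    (he : e₀ ≠ 0 ∨ e₁ ≠ 0 ∨ e₂ ≠ 0) (hf : f₀ ≠ 0 ∨ f₁ ≠ 0 ∨ f₂ ≠ 0)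
    (hg : g₀ ≠ 0 ∨ g₁ ≠ 0 ∨ g₂ ≠ 0) (hh : h₀ ≠ 0 ∨ h₁ ≠ 0 ∨ h₂ ≠ 0)
    (he' : e₁ = 0 → e₀ = 0 ∨ e₂ = 0) (hf' : f₁ = 0 → f₀ = 0 ∨ f₂ = 0)
    (hg' : g₁ = 0 → g₀ = 0 ∨ g₂ = 0) (hh' : h₁ = 0 → h₀ = 0 ∨ h₂ = 0)
    (hef : e₁ * f₁ = 0) (hgh : g₁ * h₁ = 0)
    (hΔ : l * (e₁ * f₂) - l ^ 3 / 3 * (e₂ * f₁) - l ^ 2 * (e₂ * f₀) - l ^ 4 / 12 * (e₂ * f₂) = 0 ↔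
      l * (g₁ * h₂) - l ^ 3 / 3 * (g₂ * h₁) - l ^ 2 * (g₂ * h₀) - l ^ 4 / 12 * (g₂ * h₂) = 0)
    (h1 : ∀ t : ℝ, (t ^ 2 * (e₀ * f₀) + e₂ * f₂) * (t * (g₁ * h₀) + g₂ * h₁) =
      (t ^ 2 * (g₀ * h₀) + g₂ * h₂) * (t * (e₁ * f₀) + e₂ * f₁))
    (h2 : ∀ t : ℝ, (t ^ 2 * (e₀ * f₀) + e₂ * f₂) * (t * (g₀ * h₁) + g₁ * h₂) =
      (t ^ 2 * (g₀ * h₀) + g₂ * h₂) * (t * (e₀ * f₁) + e₁ * f₂))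
    (h3 : ∀ t : ℝ, (t ^ 2 * (e₀ * f₀) + e₂ * f₂) * (t * (g₀ * h₂) - g₂ * h₀) =
      (t ^ 2 * (g₀ * h₀) + g₂ * h₂) * (t * (e₀ * f₂) - e₂ * f₀))
    (h4 : ∀ t : ℝ, (t * (e₁ * f₀) + e₂ * f₁) * (t * (g₀ * h₁) + g₁ * h₂) =
      (t * (g₁ * h₀) + g₂ * h₁) * (t * (e₀ * f₁) + e₁ * f₂))
    (h5 : ∀ t : ℝ, (t * (e₁ * f₀) + e₂ * f₁) * (t * (g₀ * h₂) - g₂ * h₀) =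
      (t * (g₁ * h₀) + g₂ * h₁) * (t * (e₀ * f₂) - e₂ * f₀))
    (h6 : ∀ t : ℝ, (t * (e₀ * f₁) + e₁ * f₂) * (t * (g₀ * h₂) - g₂ * h₀) =
      (t * (g₀ * h₁) + g₁ * h₂) * (t * (e₀ * f₂) - e₂ * f₀)) :
    (e₀ * g₁ = e₁ * g₀ ∧ e₀ * g₂ = e₂ * g₀ ∧ e₁ * g₂ = e₂ * g₁) ∧
      (f₀ * h₁ = f₁ * h₀ ∧ f₀ * h₂ = f₂ * h₀ ∧ f₁ * h₂ = f₂ * h₁) := by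
  obtain ⟨k1, k2, k3, k4⟩ := cubic_coeffs_eq_zero (e₀ * f₀ * (g₁ * h₀) - g₀ * h₀ * (e₁ * f₀))
    (e₀ * f₀ * (g₂ * h₁) - g₀ * h₀ * (e₂ * f₁)) (e₂ * f₂ * (g₁ * h₀) - g₂ * h₂ * (e₁ * f₀))
    (e₂ * f₂ * (g₂ * h₁) - g₂ * h₂ * (e₂ * f₁)) fun t => by linear_combination h1 t
  obtain ⟨k5, k6, k7, k8⟩ := cubic_coeffs_eq_zero (e₀ * f₀ * (g₀ * h₁) - g₀ * h₀ * (e₀ * f₁))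
    (e₀ * f₀ * (g₁ * h₂) - g₀ * h₀ * (e₁ * f₂)) (e₂ * f₂ * (g₀ * h₁) - g₂ * h₂ * (e₀ * f₁))
    (e₂ * f₂ * (g₁ * h₂) - g₂ * h₂ * (e₁ * f₂)) fun t => by linear_combination h2 t
  obtain ⟨k9, k10, k11, k12⟩ := cubic_coeffs_eq_zero (e₀ * f₀ * (g₀ * h₂) - g₀ * h₀ * (e₀ * f₂))
    (-(e₀ * f₀ * (g₂ * h₀)) + g₀ * h₀ * (e₂ * f₀)) (e₂ * f₂ * (g₀ * h₂) - g₂ * h₂ * (e₀ * f₂))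
    (-(e₂ * f₂ * (g₂ * h₀)) + g₂ * h₂ * (e₂ * f₀)) fun t => by linear_combination h3 t
  obtain ⟨-, k13, k14, k15⟩ := cubic_coeffs_eq_zero 0 (e₁ * f₀ * (g₀ * h₁) - g₁ * h₀ * (e₀ * f₁))
    (e₁ * f₀ * (g₁ * h₂) + e₂ * f₁ * (g₀ * h₁) - g₁ * h₀ * (e₁ * f₂) - g₂ * h₁ * (e₀ * f₁))
    (e₂ * f₁ * (g₁ * h₂) - g₂ * h₁ * (e₁ * f₂)) fun t => by linear_combination h4 t
  obtain ⟨-, k16, k17, k18⟩ := cubic_coeffs_eq_zero 0 (e₁ * f₀ * (g₀ * h₂) - g₁ * h₀ * (e₀ * f₂))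
    (-(e₁ * f₀ * (g₂ * h₀)) + e₂ * f₁ * (g₀ * h₂) + g₁ * h₀ * (e₂ * f₀) - g₂ * h₁ * (e₀ * f₂))
    (-(e₂ * f₁ * (g₂ * h₀)) + g₂ * h₁ * (e₂ * f₀)) fun t => by linear_combination h5 t
  obtain ⟨-, k19, k20, k21⟩ := cubic_coeffs_eq_zero 0 (e₀ * f₁ * (g₀ * h₂) - g₀ * h₁ * (e₀ * f₂))
    (-(e₀ * f₁ * (g₂ * h₀)) + e₁ * f₂ * (g₀ * h₂) + g₀ * h₁ * (e₂ * f₀) - g₁ * h₂ * (e₀ * f₂))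
    (-(e₁ * f₂ * (g₂ * h₀)) + g₁ * h₂ * (e₂ * f₀)) fun t => by linear_combination h6 t
  have hq := rigid_sum_ne_zero hl hf₀ hf₁ hf₂ hf
  have hq' := rigid_sum_ne_zero hl hh₀ hh₁ hh₂ hh
  -- From here on the criterion for the eigenvalue `0` is `l e₁ f₂ = e₂ Q`, and `Q ≠ 0` is all that
  -- is needed about `Q`.
  generalize hQ : l ^ 3 / 3 * f₁ + l ^ 2 * f₀ + l ^ 4 / 12 * f₂ = Q at hq
  generalize hQ' : l ^ 3 / 3 * h₁ + l ^ 2 * h₀ + l ^ 4 / 12 * h₂ = Q' at hq'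
  have hΔ' : l * (e₁ * f₂) - e₂ * Q = 0 ↔ l * (g₁ * h₂) - g₂ * Q' = 0 := by
    rw [← hQ, ← hQ']; convert hΔ using 2 <;> ring
  have hl0 := hl.ne'
  have ca := degenerate_cases hef he' hf'
  have cb := degenerate_cases hgh hg' hh'
  clear h1 h2 h3 h4 h5 h6 hΔ hf₀ hf₁ hf₂ hh₀ hh₁ hh₂ hl hQ hQ'
  -- Sixteen combinations of shapes. Substituting zeros leaves monomial relations; pairs differing
  -- by a power of `t` are excluded by `hΔ'`.
  rcases ca with ⟨ra, rb⟩ | ⟨ra, rb⟩ | ⟨ra, rb⟩ | ⟨ra, rb⟩ <;>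
  rcases cb with ⟨rc, rd⟩ | ⟨rc, rd⟩ | ⟨rc, rd⟩ | ⟨rc, rd⟩ <;>
  subst ra rb rc rd <;>
  simp only [mul_zero, zero_mul, sub_zero, zero_sub, add_zero, zero_add, neg_zero, neg_eq_zero,
    mul_eq_zero, ne_eq, not_true_eq_false, or_false, false_or, true_or, or_true, sub_self,
    true_iff, iff_true, forall_const, and_true, true_and] at * <;>
  grind

/-! ### Fundamental systems and uniqueness for the initial value problem -/

/-- A fundamental system of `y'''' = lam * y`: the functions `K j` satisfy
`K j ^ (i) (0) = δ i j` for `i < 4`. -/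
structure FundamentalSystem (lam : ℂ) where
  K₀ : ℝ → ℂ
  K₁ : ℝ → ℂ
  K₂ : ℝ → ℂ
  K₃ : ℝ → ℂ
  deriv₀ : ∀ x, HasDerivAt K₀ (lam * K₃ x) x
  deriv₁ : ∀ x, HasDerivAt K₁ (K₀ x) x
  deriv₂ : ∀ x, HasDerivAt K₂ (K₁ x) x
  deriv₃ : ∀ x, HasDerivAt K₃ (K₂ x) x
  init₀ : K₀ 0 = 1
  init₁ : K₁ 0 = 0
  init₂ : K₂ 0 = 0
  init₃ : K₃ 0 = 0

namespace FundamentalSystem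

variable {lam : ℂ} (S : FundamentalSystem lam)

/-- The solution with initial data `c₀, c₁, c₂, c₃`. -/
def sol (S : FundamentalSystem lam) (c₀ c₁ c₂ c₃ : ℂ) : ℝ → ℂ := fun x =>
  c₀ * S.K₀ x + c₁ * S.K₁ x + c₂ * S.K₂ x + c₃ * S.K₃ x

theorem hasDerivAt_sol (c₀ c₁ c₂ c₃ : ℂ) (x : ℝ) :
    HasDerivAt (S.sol c₀ c₁ c₂ c₃) (S.sol c₁ c₂ c₃ (lam * c₀) x) x := by
  have h := ((((S.deriv₀ x).const_mul c₀).add ((S.deriv₁ x).const_mul c₁)).add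
    ((S.deriv₂ x).const_mul c₂)).add ((S.deriv₃ x).const_mul c₃)
  exact h.congr_deriv (by simp only [sol]; ring)

theorem sol_zero (c₀ c₁ c₂ c₃ : ℂ) : S.sol c₀ c₁ c₂ c₃ 0 = c₀ := by
  simp [sol, S.init₀, S.init₁, S.init₂, S.init₃]

theorem contDiff_sol (n : ℕ) : ∀ c₀ c₁ c₂ c₃ : ℂ, ContDiff ℝ n (S.sol c₀ c₁ c₂ c₃) := by
  induction n with
  | zero =>
    intro c₀ c₁ c₂ c₃
    exact contDiff_zero.2 (continuous_iff_continuousAt.2 fun x =>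
      (S.hasDerivAt_sol c₀ c₁ c₂ c₃ x).continuousAt)
  | succ n ih =>
    intro c₀ c₁ c₂ c₃
    have h := contDiff_succ_iff_deriv (n := (n : WithTop ℕ∞)) (f := S.sol c₀ c₁ c₂ c₃) (𝕜 := ℝ)
    push_cast
    refine h.2 ⟨fun x => (S.hasDerivAt_sol c₀ c₁ c₂ c₃ x).differentiableAt, by simp, ?_⟩
    rw [funext fun x => (S.hasDerivAt_sol c₀ c₁ c₂ c₃ x).deriv]
    exact ih _ _ _ _

theorem iteratedDerivWithin_succ_of_eqOn {s : Set ℝ} (hs : UniqueDiffOn ℝ s) {y f g : ℝ → ℂ} {n : ℕ}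
    (h : Set.EqOn (iteratedDerivWithin n y s) f s) (hf : ∀ x, HasDerivAt f (g x) x) :
    Set.EqOn (iteratedDerivWithin (n + 1) y s) g s := by
  intro x hx
  rw [iteratedDerivWithin_succ, derivWithin_congr h (h hx)]
  exact ((hf x).hasDerivWithinAt).derivWithin (hs x hx)

theorem iteratedDerivWithin_of_eqOn {s : Set ℝ} (hs : UniqueDiffOn ℝ s) {y : ℝ → ℂ}
    {c₀ c₁ c₂ c₃ : ℂ} (h : Set.EqOn y (S.sol c₀ c₁ c₂ c₃) s) :
    Set.EqOn (iteratedDerivWithin 1 y s) (S.sol c₁ c₂ c₃ (lam * c₀)) s ∧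
    Set.EqOn (iteratedDerivWithin 2 y s) (S.sol c₂ c₃ (lam * c₀) (lam * c₁)) s ∧
    Set.EqOn (iteratedDerivWithin 3 y s) (S.sol c₃ (lam * c₀) (lam * c₁) (lam * c₂)) s ∧
    Set.EqOn (iteratedDerivWithin 4 y s)
      (S.sol (lam * c₀) (lam * c₁) (lam * c₂) (lam * c₃)) s := by
  have h0 : Set.EqOn (iteratedDerivWithin 0 y s) (S.sol c₀ c₁ c₂ c₃) s := by
    simpa [iteratedDerivWithin_zero] using h
  have h1 := iteratedDerivWithin_succ_of_eqOn hs h0 (S.hasDerivAt_sol _ _ _ _)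
  have h2 := iteratedDerivWithin_succ_of_eqOn hs h1 (S.hasDerivAt_sol _ _ _ _)
  have h3 := iteratedDerivWithin_succ_of_eqOn hs h2 (S.hasDerivAt_sol _ _ _ _)
  have h4 := iteratedDerivWithin_succ_of_eqOn hs h3 (S.hasDerivAt_sol _ _ _ _)
  exact ⟨h1, h2, h3, h4⟩

/-- A solution on `[0, l]` is determined by its initial data. -/
theorem eqOn_sol {l : ℝ} (hl : 0 < l) {y : ℝ → ℂ} (hy : ContDiffOn ℝ 4 y (Set.Icc 0 l))
    (hode : ∀ x ∈ Set.Icc 0 l, iteratedDerivWithin 4 y (Set.Icc 0 l) x = lam * y x) :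
    Set.EqOn y (S.sol (y 0) (iteratedDerivWithin 1 y (Set.Icc 0 l) 0)
      (iteratedDerivWithin 2 y (Set.Icc 0 l) 0) (iteratedDerivWithin 3 y (Set.Icc 0 l) 0))
      (Set.Icc 0 l) := by
  intro T hT
  set I := Set.Icc (0 : ℝ) l with hI
  have hu : UniqueDiffOn ℝ I := uniqueDiffOn_Icc hl
  set Y : ℕ → ℝ → ℂ := fun n => iteratedDerivWithin n y I with hYdef
  have hY : ∀ n < 4, ∀ x ∈ I, HasDerivWithinAt (Y n) (Y (n + 1) x) I x := by
    intro n hn x hx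
    have hd : DifferentiableOn ℝ (Y n) I :=
      hy.differentiableOn_iteratedDerivWithin (by exact_mod_cast hn) hu
    simp only [hYdef, iteratedDerivWithin_succ]
    exact (hd x hx).hasDerivWithinAt
  have hrev : ∀ {f g : ℝ → ℂ}, (∀ x, HasDerivAt f (g x) x) → ∀ x : ℝ,
      HasDerivAt (fun x => f (T - x)) (-(g (T - x))) x := by
    intro f g h x
    simpa using (h (T - x)).comp_const_sub T x
  -- `F x` propagates the data of `y` at `x` forward to `T`. It is constant by the equation, with `F
  -- T = y T` and `F 0` the value at `T` of the solution with the data at `0`.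
  set F : ℝ → ℂ := fun x => Y 0 x * S.K₀ (T - x) + Y 1 x * S.K₁ (T - x) + Y 2 x * S.K₂ (T - x)
    + Y 3 x * S.K₃ (T - x) with hF
  have hF' : ∀ x ∈ I, HasDerivWithinAt F 0 I x := by
    intro x hx
    have h := ((((hY 0 (by norm_num) x hx).mul (hrev S.deriv₀ x).hasDerivWithinAt).add
      ((hY 1 (by norm_num) x hx).mul (hrev S.deriv₁ x).hasDerivWithinAt)).add
      ((hY 2 (by norm_num) x hx).mul (hrev S.deriv₂ x).hasDerivWithinAt)).add
      ((hY 3 (by norm_num) x hx).mul (hrev S.deriv₃ x).hasDerivWithinAt)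
    have h4 : Y 4 x = lam * Y 0 x := by simpa [hYdef] using hode x hx
    refine h.congr_deriv ?_
    norm_num [h4]
    ring
  have hconst := constant_of_derivWithin_zero (f := F) (a := 0) (b := l)
    (fun x hx => (hF' x hx).differentiableWithinAt)
    (fun x hx => (hF' x (Set.Ico_subset_Icc_self hx)).derivWithin
      (hu x (Set.Ico_subset_Icc_self hx))) T hT
  simp only [hF, sub_self, S.init₀, S.init₁, S.init₂, S.init₃, sub_zero] at hconst
  simpa [hYdef, sol] using hconst

end FundamentalSystem

/-! ### The characteristic determinant -/

namespace RodBC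

/-- The characteristic determinant of the boundary value problem in terms of the values at `l` of a
fundamental system. -/
def charDet {R : Type*} [CommRing R] (a₁ a₂ a₃ a₄ a₅ a₆ a₇ a₈ lam k₀ k₁ k₂ k₃ : R) : R :=
  (a₅ * (a₄ * k₀ + a₁ * k₃) + a₈ * (a₄ * (lam * k₁) + a₁ * k₀)) *
    (a₆ * (a₃ * k₀ + a₂ * k₁) + a₇ * (a₃ * (lam * k₃) + a₂ * k₀)) -
  (a₅ * (a₃ * k₁ + a₂ * k₂) + a₈ * (a₃ * (lam * k₂) + a₂ * (lam * k₃))) *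
    (a₆ * (a₄ * (lam * k₃) + a₁ * k₂) + a₇ * (a₄ * (lam * k₂) + a₁ * k₁))

/-- Solutions of the boundary value problem in terms of their initial data. -/
theorem isSolution_iff {lam : ℂ} (S : FundamentalSystem lam) (a : RodBC) {l : ℝ} (hl : 0 < l) {s : ℂ}
    (hs : s ^ 2 = lam) {y : ℝ → ℂ} {c₀ c₁ c₂ c₃ : ℂ}
    (h : Set.EqOn y (S.sol c₀ c₁ c₂ c₃) (Set.Icc 0 l)) :
    a.IsSolution l s y ↔ -(a.a₁ : ℂ) * c₀ + a.a₄ * c₃ = 0 ∧ -(a.a₂ : ℂ) * c₁ + a.a₃ * c₂ = 0 ∧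
      (a.a₅ : ℂ) * S.sol c₀ c₁ c₂ c₃ l + a.a₈ * S.sol c₃ (lam * c₀) (lam * c₁) (lam * c₂) l = 0 ∧
      (a.a₆ : ℂ) * S.sol c₁ c₂ c₃ (lam * c₀) l + a.a₇ * S.sol c₂ c₃ (lam * c₀) (lam * c₁) l = 0 := by
  have h0 : (0 : ℝ) ∈ Set.Icc 0 l := ⟨le_rfl, hl.le⟩
  have h1 : l ∈ Set.Icc 0 l := ⟨hl.le, le_rfl⟩
  obtain ⟨d1, d2, d3, d4⟩ := S.iteratedDerivWithin_of_eqOn (uniqueDiffOn_Icc hl) h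
  unfold IsSolution
  rw [d1 h0, d2 h0, d3 h0, d1 h1, d2 h1, d3 h1, h h0, h h1]
  simp only [S.sol_zero]
  constructor
  · rintro ⟨-, -, h⟩
    exact h
  · intro hbc
    refine ⟨((S.contDiff_sol 4 c₀ c₁ c₂ c₃).contDiffOn).congr h, fun x hx => ?_, hbc⟩
    rw [d4 hx, h hx, hs]
    simp only [FundamentalSystem.sol]; ring

/-- A nontrivial homogeneous linear condition on a pair is solved by the multiples of one pair. -/
theorem exists_mul_of_linear_relation {r t : ℝ} (h : r ≠ 0 ∨ t ≠ 0) {c d : ℂ}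
    (hcd : -(r : ℂ) * c + t * d = 0) : ∃ p : ℂ, c = t * p ∧ d = r * p := by
  rcases h with h | h
  · have h' : (r : ℂ) ≠ 0 := by exact_mod_cast h
    exact ⟨d / r, by field_simp; linear_combination -hcd, by field_simp⟩
  · have h' : (t : ℂ) ≠ 0 := by exact_mod_cast h
    exact ⟨c / t, by field_simp, by field_simp; linear_combination hcd⟩

theorem exists_kernel_of_det_eq_zero {A B C D : ℂ} (h : A * D - B * C = 0) :
    ∃ p q : ℂ, (p ≠ 0 ∨ q ≠ 0) ∧ A * p + B * q = 0 ∧ C * p + D * q = 0 := by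
  by_cases hAB : A = 0 ∧ B = 0
  · obtain ⟨rfl, rfl⟩ := hAB
    by_cases hCD : C = 0 ∧ D = 0
    · obtain ⟨rfl, rfl⟩ := hCD
      exact ⟨1, 0, by simp⟩
    · exact ⟨D, -C, by rw [neg_ne_zero]; tauto, by ring, by ring⟩
  · exact ⟨B, -A, by rw [neg_ne_zero]; tauto, by ring, by linear_combination -h⟩

/-- `Module.finrank` is `0` on infinite-dimensional spaces, so finiteness is needed before a nonzero
multiplicity can be equated with a nontrivial eigenspace. -/
theorem finiteDimensional_eigenspace {lam : ℂ} (S : FundamentalSystem lam) (a : RodBC) {l : ℝ}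
    (hl : 0 < l) {s : ℂ} (hs : s ^ 2 = lam) : FiniteDimensional ℂ (a.eigenspace l hl s) := by
  set I := Set.Icc (0 : ℝ) l
  have hfin : FiniteDimensional ℂ (Submodule.span ℂ
      (Set.range ![I.indicator S.K₀, I.indicator S.K₁, I.indicator S.K₂, I.indicator S.K₃])) :=
    FiniteDimensional.span_of_finite ℂ (Set.finite_range _)
  refine Submodule.finiteDimensional_of_le (S₂ := Submodule.span ℂ
      (Set.range ![I.indicator S.K₀, I.indicator S.K₁, I.indicator S.K₂, I.indicator S.K₃])) ?_
  rintro y ⟨⟨hy, hode, -⟩, hy0⟩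
  rw [hs] at hode
  have heq := S.eqOn_sol hl hy hode
  rw [Submodule.mem_span_range_iff_exists_fun]
  refine ⟨![y 0, iteratedDerivWithin 1 y I 0, iteratedDerivWithin 2 y I 0,
    iteratedDerivWithin 3 y I 0], ?_⟩
  ext x
  by_cases hx : x ∈ I
  · rw [heq hx]
    simp [Fin.sum_univ_four, hx, FundamentalSystem.sol, I]
  · rw [hy0 x hx]
    simp [Fin.sum_univ_four, hx]

/-- `s` is an eigenvalue if and only if the characteristic determinant vanishes. -/
theorem multiplicity_ne_zero_iff {lam : ℂ} (S : FundamentalSystem lam) (a : RodBC)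
    (ha : a.Nondegenerate) {l : ℝ} (hl : 0 < l) {s : ℂ} (hs : s ^ 2 = lam) :
    a.multiplicity l hl s ≠ 0 ↔ charDet (a.a₁ : ℂ) a.a₂ a.a₃ a.a₄ a.a₅ a.a₆ a.a₇ a.a₈ lam
      (S.K₀ l) (S.K₁ l) (S.K₂ l) (S.K₃ l) = 0 := by
  obtain ⟨n₁, n₂, -, -⟩ := ha
  have := finiteDimensional_eigenspace S a hl hs
  rw [multiplicity, Ne, Submodule.finrank_eq_zero, ← Ne, Submodule.ne_bot_iff]
  constructor
  · rintro ⟨y, ⟨hy, hy0⟩, hne⟩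
    have heq := S.eqOn_sol hl hy.1 (by simpa only [hs] using hy.2.1)
    generalize iteratedDerivWithin 1 y (Set.Icc 0 l) 0 = c₁ at heq
    generalize iteratedDerivWithin 2 y (Set.Icc 0 l) 0 = c₂ at heq
    generalize iteratedDerivWithin 3 y (Set.Icc 0 l) 0 = c₃ at heq
    generalize y 0 = c₀ at heq
    obtain ⟨b₁, b₂, b₃, b₄⟩ := (isSolution_iff S a hl hs heq).1 hy
    -- The conditions at `0` leave two parameters `p, q`. The conditions at `l` are then a 2 × 2
    -- system with determinant `charDet`, solved below by Cramer's rule.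
    obtain ⟨p, rfl, rfl⟩ := exists_mul_of_linear_relation n₁ b₁
    obtain ⟨q, rfl, rfl⟩ := exists_mul_of_linear_relation n₂ b₂
    simp only [FundamentalSystem.sol] at b₃ b₄
    by_contra hdet
    have hp : p = 0 := by
      apply (mul_eq_zero_iff_left hdet).1
      unfold charDet
      linear_combination (a.a₆ * (a.a₃ * S.K₀ l + a.a₂ * S.K₁ l) +
          a.a₇ * (a.a₃ * (lam * S.K₃ l) + a.a₂ * S.K₀ l)) * b₃ -
        (a.a₅ * (a.a₃ * S.K₁ l + a.a₂ * S.K₂ l) +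
          a.a₈ * (a.a₃ * (lam * S.K₂ l) + a.a₂ * (lam * S.K₃ l))) * b₄
    have hq : q = 0 := by
      apply (mul_eq_zero_iff_left hdet).1
      unfold charDet
      linear_combination (a.a₅ * (a.a₄ * S.K₀ l + a.a₁ * S.K₃ l) +
          a.a₈ * (a.a₄ * (lam * S.K₁ l) + a.a₁ * S.K₀ l)) * b₄ -
        (a.a₆ * (a.a₄ * (lam * S.K₃ l) + a.a₁ * S.K₂ l) +
          a.a₇ * (a.a₄ * (lam * S.K₂ l) + a.a₁ * S.K₁ l)) * b₃
    apply hne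
    ext x
    by_cases hx : x ∈ Set.Icc 0 l
    · rw [heq hx]; simp [FundamentalSystem.sol, hp, hq]
    · exact hy0 x hx
  · intro hdet
    obtain ⟨p, q, hpq, hp, hq⟩ := exists_kernel_of_det_eq_zero hdet
    have heq : Set.EqOn ((Set.Icc 0 l).indicator (S.sol (a.a₄ * p) (a.a₃ * q) (a.a₂ * q) (a.a₁ * p)))
        (S.sol (a.a₄ * p) (a.a₃ * q) (a.a₂ * q) (a.a₁ * p)) (Set.Icc 0 l) :=
      fun x hx => Set.indicator_of_mem hx _
    refine ⟨_, ⟨(isSolution_iff S a hl hs heq).2 ⟨by ring, by ring, ?_, ?_⟩,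
      fun x hx => Set.indicator_of_notMem hx _⟩, fun h0 => ?_⟩
    · simp only [FundamentalSystem.sol]; linear_combination hp
    · simp only [FundamentalSystem.sol]; linear_combination hq
    -- A zero solution has zero initial data `a₄ p, a₃ q, a₂ q, a₁ p`, which forces `p = q = 0` by
    -- nondegeneracy.
    · rw [h0] at heq
      obtain ⟨d1, d2, d3, -⟩ := S.iteratedDerivWithin_of_eqOn (uniqueDiffOn_Icc hl) heq
      have hmem : (0 : ℝ) ∈ Set.Icc 0 l := ⟨le_rfl, hl.le⟩
      have z0 := heq hmem
      have z1 := d1 hmem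
      have z2 := d2 hmem
      have z3 := d3 hmem
      have hz : ∀ n, iteratedDerivWithin n (0 : ℝ → ℂ) (Set.Icc 0 l) 0 = 0 := by simp
      rw [S.sol_zero, hz] at z1 z2 z3
      rw [S.sol_zero, Pi.zero_apply] at z0
      simp only [zero_eq_mul, Complex.ofReal_eq_zero] at z0 z1 z2 z3
      tauto

end RodBC
-- Exponential polynomials, elimination and large roots
open Polynomial Filter Topology

theorem tendsto_polynomial_mul_exp_neg (p : ℝ[X]) {l : ℝ} (hl : 0 < l) :
    Tendsto (fun z : ℝ => p.eval z * Real.exp (-(l * z))) atTop (𝓝 0) := by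
  have h := (Polynomial.tendsto_div_exp_atTop (p.comp (C l⁻¹ * X))).comp
    (tendsto_id.const_mul_atTop hl)
  refine h.congr fun z => ?_
  have hz : l⁻¹ * (l * z) = z := by field_simp
  simp [hz, Real.exp_neg, div_eq_mul_inv]

theorem tendsto_evalEval_mul_exp_neg (H : ℝ[X][X]) {l : ℝ} (hl : 0 < l) :
    Tendsto (fun z : ℝ => H.evalEval z (Real.exp (-(l * z))) * Real.exp (-(l * z)))
      atTop (𝓝 0) := by
  have hε : Tendsto (fun z : ℝ => Real.exp (-(l * z))) atTop (𝓝 0) := by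
    simpa using tendsto_polynomial_mul_exp_neg 1 hl
  induction H using Polynomial.induction_on' with
  | add p q hp hq =>
    simpa [add_mul] using hp.add hq
  | monomial n p =>
    have h := (tendsto_polynomial_mul_exp_neg p hl).mul (hε.pow n)
    rw [zero_mul] at h
    refine h.congr fun z => ?_
    rw [← C_mul_X_pow_eq_monomial]
    simp only [evalEval_mul, evalEval_C, evalEval_pow, evalEval_X]
    ring

/-- A nonzero polynomial is eventually bounded away from `0`. -/
theorem polynomial_eq_zero_of_frequently_eq {p : ℝ[X]} {g : ℝ → ℝ} (hg : Tendsto g atTop (𝓝 0))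
    (h : ∃ᶠ z in atTop, p.eval z = g z) : p = 0 := by
  by_contra hp
  have hev : ∃ δ > 0, ∀ᶠ z in atTop, δ ≤ |p.eval z| := by
    by_cases hdeg : 0 < p.degree
    · exact ⟨1, one_pos, (p.abs_tendsto_atTop hdeg).eventually_ge_atTop 1⟩
    · have hc := eq_C_of_degree_le_zero (not_lt.1 hdeg)
      refine ⟨|p.coeff 0|, abs_pos.2 fun h0 => hp (by rw [hc, h0, C_0]), ?_⟩
      rw [hc]
      simp
  obtain ⟨δ, hδ, hev⟩ := hev
  have hsmall : ∀ᶠ z in atTop, |g z| < δ := by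
    have := hg.abs
    rw [abs_zero] at this
    exact this.eventually_lt_const hδ
  obtain ⟨z, hz, h1, h2⟩ := (h.and_eventually (hev.and hsmall)).exists
  rw [hz] at h1
  linarith

/-- A polynomial in `z` and `exp (-l z)` that vanishes for arbitrarily large `z` is zero. -/
theorem eq_zero_of_frequently_evalEval_exp {l : ℝ} (hl : 0 < l) (G : ℝ[X][X])
    (h : ∃ᶠ z in atTop, G.evalEval z (Real.exp (-(l * z))) = 0) : G = 0 := by
  induction hn : G.natDegree using Nat.strong_induction_on generalizing G with
  | _ n ih =>
    have hG := G.divX_mul_X_add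
    have hval : ∀ z y : ℝ, G.evalEval z y = G.divX.evalEval z y * y + (G.coeff 0).eval z := by
      intro z y
      conv_lhs => rw [← hG]
      simp only [evalEval_add, evalEval_mul, evalEval_C, evalEval_X]
    -- At the given roots the part free of the exponential equals minus a multiple of `exp (-l z)`,
    -- which tends to `0`. Once it is known to vanish, a factor `exp (-l z)` cancels and the degree
    -- drops.
    have h0 : G.coeff 0 = 0 := by
      refine polynomial_eq_zero_of_frequently_eq
        (g := fun z => -(G.divX.evalEval z (Real.exp (-(l * z))) * Real.exp (-(l * z)))) ?_ ?_
      · simpa using (tendsto_evalEval_mul_exp_neg G.divX hl).neg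
      · refine h.mono fun z hz => ?_
        rw [hval] at hz
        linarith
    have hdiv : ∃ᶠ z in atTop, G.divX.evalEval z (Real.exp (-(l * z))) = 0 := by
      refine h.mono fun z hz => ?_
      rw [hval, h0, eval_zero, add_zero] at hz
      exact (mul_eq_zero.1 hz).resolve_right (Real.exp_ne_zero _)
    by_cases hd : G.natDegree = 0
    · rw [eq_C_of_natDegree_eq_zero hd, h0, C_0]
    · have hX : G.divX = 0 :=
        ih G.divX.natDegree (by rw [natDegree_divX_eq_natDegree_tsub_one]; omega) _ hdiv rfl
      rw [← hG, hX, h0]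
      simp

/-- Elimination of `cos` and `sin` from two frequency equations with arbitrarily large common
roots. -/
theorem frequency_equation_elimination {l : ℝ} (hl : 0 < l)
    (x y t w r x' y' t' w' r' : ℝ[X])
    (h : ∃ᶠ z in atTop, ∃ c s ε : ℝ, c ^ 2 + s ^ 2 = 1 ∧ ε ^ 2 = Real.exp (-(l * z)) ∧
      (x.eval z * (1 + ε ^ 2) + y.eval z * (1 - ε ^ 2)) * c +
        (t.eval z * (1 + ε ^ 2) + w.eval z * (1 - ε ^ 2)) * s + 2 * ε * r.eval z = 0 ∧
      (x'.eval z * (1 + ε ^ 2) + y'.eval z * (1 - ε ^ 2)) * c +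
        (t'.eval z * (1 + ε ^ 2) + w'.eval z * (1 - ε ^ 2)) * s + 2 * ε * r'.eval z = 0) (z : ℝ) :
    r.eval z * x'.eval z = r'.eval z * x.eval z ∧ r.eval z * y'.eval z = r'.eval z * y.eval z ∧
    r.eval z * t'.eval z = r'.eval z * t.eval z ∧ r.eval z * w'.eval z = r'.eval z * w.eval z ∧
    x.eval z * t'.eval z = x'.eval z * t.eval z ∧ y.eval z * w'.eval z = y'.eval z * w.eval z ∧
    x.eval z * w'.eval z + y.eval z * t'.eval z = x'.eval z * w.eval z + y'.eval z * t.eval z := by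
  let A : ℝ[X][X] := C x * (1 + X) + C y * (1 - X)
  let B : ℝ[X][X] := C t * (1 + X) + C w * (1 - X)
  let A' : ℝ[X][X] := C x' * (1 + X) + C y' * (1 - X)
  let B' : ℝ[X][X] := C t' * (1 + X) + C w' * (1 - X)
  -- Cramer's rule for `(c, s)` combined with `c ^ 2 + s ^ 2 = 1`; the outer variable stands for `ε
  -- ^ 2`.
  let G : ℝ[X][X] := (A * B' - A' * B) ^ 2 -
    4 * X * ((C r * B' - C r' * B) ^ 2 + (A * C r' - A' * C r) ^ 2)
  have h1 : ∀ u v : ℝ, (1 : ℝ[X][X]).evalEval u v = 1 := fun u v => by simp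
  have h4 : ∀ u v : ℝ, (4 : ℝ[X][X]).evalEval u v = 4 := fun u v => by
    simp [evalEval]
  have hG : G = 0 := by
    refine eq_zero_of_frequently_evalEval_exp hl G (h.mono ?_)
    rintro z ⟨c, s, ε, hcs, hε, ha, hb⟩
    rw [← hε]
    simp only [G, A, B, A', B', evalEval_add, evalEval_sub, evalEval_mul, evalEval_pow, evalEval_C,
      evalEval_X, h1, h4]
    generalize x.eval z * (1 + ε ^ 2) + y.eval z * (1 - ε ^ 2) = a at *
    generalize t.eval z * (1 + ε ^ 2) + w.eval z * (1 - ε ^ 2) = b at *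
    generalize x'.eval z * (1 + ε ^ 2) + y'.eval z * (1 - ε ^ 2) = a' at *
    generalize t'.eval z * (1 + ε ^ 2) + w'.eval z * (1 - ε ^ 2) = b' at *
    have hc : (a * b' - a' * b) * c = -(2 * ε * (r.eval z * b' - r'.eval z * b)) := by
      linear_combination b' * ha - b * hb
    have hs : (a * b' - a' * b) * s = -(2 * ε * (a * r'.eval z - a' * r.eval z)) := by
      linear_combination a * hb - a' * ha
    have e1 := congrArg (· ^ 2) hc
    have e2 := congrArg (· ^ 2) hs
    linear_combination e1 + e2 - (a * b' - a' * b) ^ 2 * hcs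
  -- Since `G = 0` identically, the outer variable may be negative. There `G` is a sum of
  -- nonnegative terms, so each square vanishes separately.
  have key : ∀ η : ℝ, η < 0 → ∀ a b a' b' : ℝ,
      a = x.eval z * (1 + η) + y.eval z * (1 - η) → b = t.eval z * (1 + η) + w.eval z * (1 - η) →
      a' = x'.eval z * (1 + η) + y'.eval z * (1 - η) →
      b' = t'.eval z * (1 + η) + w'.eval z * (1 - η) →
      a * b' - a' * b = 0 ∧ r.eval z * b' - r'.eval z * b = 0 ∧
        a * r'.eval z - a' * r.eval z = 0 := by
    rintro η hη a b a' b' ea eb ea' eb'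
    have hz : G.evalEval z η = 0 := by rw [hG, evalEval_zero]
    simp only [G, A, B, A', B', evalEval_add, evalEval_sub, evalEval_mul, evalEval_pow, evalEval_C,
      evalEval_X, h1, h4, ← ea, ← eb, ← ea', ← eb'] at hz
    have q1 := sq_nonneg (a * b' - a' * b)
    have q2 := mul_nonneg (neg_nonneg.2 hη.le) (sq_nonneg (r.eval z * b' - r'.eval z * b))
    have q3 := mul_nonneg (neg_nonneg.2 hη.le) (sq_nonneg (a * r'.eval z - a' * r.eval z))
    have z2 : -η * (r.eval z * b' - r'.eval z * b) ^ 2 = 0 := by linarith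
    have z3 : -η * (a * r'.eval z - a' * r.eval z) ^ 2 = 0 := by linarith
    have hη' : -η ≠ 0 := by linarith
    exact ⟨pow_eq_zero_iff two_ne_zero |>.1 (by linarith),
      pow_eq_zero_iff two_ne_zero |>.1 ((mul_eq_zero.1 z2).resolve_left hη'),
      pow_eq_zero_iff two_ne_zero |>.1 ((mul_eq_zero.1 z3).resolve_left hη')⟩
  -- The 2 × 2 determinant is quadratic in `η` and needs three values; the minors with `r` are
  -- linear and need two.
  obtain ⟨k1, k2, k3⟩ := key (-1) (by norm_num) _ _ _ _ rfl rfl rfl rfl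
  obtain ⟨k4, k5, k6⟩ := key (-2) (by norm_num) _ _ _ _ rfl rfl rfl rfl
  obtain ⟨k7, -, -⟩ := key (-3) (by norm_num) _ _ _ _ rfl rfl rfl rfl
  ring_nf at k1 k2 k3 k4 k5 k6 k7
  refine ⟨?_, ?_, ?_, ?_, ?_, ?_, ?_⟩ <;> linarith

/-- A frequency equation whose leading cosine coefficient is bounded below has arbitrarily large
roots. -/
theorem frequently_frequency_equation {l : ℝ} (hl : 0 < l) (x y t w r : ℝ[X]) {δ : ℝ} (hδ : 0 < δ)
    (h : ∀ z : ℝ, 1 ≤ z → δ ≤ x.eval z + y.eval z) :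
    ∃ᶠ z in atTop,
      (x.eval z * (1 + Real.exp (-(l * z)) ^ 2) + y.eval z * (1 - Real.exp (-(l * z)) ^ 2)) *
        Real.cos (l * z) +
      (t.eval z * (1 + Real.exp (-(l * z)) ^ 2) + w.eval z * (1 - Real.exp (-(l * z)) ^ 2)) *
        Real.sin (l * z) + 2 * Real.exp (-(l * z)) * r.eval z = 0 := by
  set F : ℝ → ℝ := fun z =>
      (x.eval z * (1 + Real.exp (-(l * z)) ^ 2) + y.eval z * (1 - Real.exp (-(l * z)) ^ 2)) *
        Real.cos (l * z) +
      (t.eval z * (1 + Real.exp (-(l * z)) ^ 2) + w.eval z * (1 - Real.exp (-(l * z)) ^ 2)) *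
        Real.sin (l * z) + 2 * Real.exp (-(l * z)) * r.eval z with hF
  have hcont : Continuous F := by
    have := x.continuous
    have := y.continuous
    have := t.continuous
    have := w.continuous
    have := r.continuous
    fun_prop
  have hr := (tendsto_polynomial_mul_exp_neg r hl).abs
  have hε : Tendsto (fun z : ℝ => Real.exp (-(l * z))) atTop (𝓝 0) := by
    simpa using tendsto_polynomial_mul_exp_neg 1 hl
  have hxy := ((tendsto_polynomial_mul_exp_neg (x - y) hl).mul hε).abs
  have hlim : Tendsto (fun z : ℝ => |(x - y).eval z * Real.exp (-(l * z)) * Real.exp (-(l * z))| +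
      2 * |r.eval z * Real.exp (-(l * z))|) atTop (𝓝 0) := by
    simpa using hxy.add (hr.const_mul 2)
  have hsmall := (hlim.eventually_lt_const hδ).and (eventually_ge_atTop (1 : ℝ))
  rw [eventually_atTop] at hsmall
  obtain ⟨N, hN⟩ := hsmall
  rw [frequently_atTop]
  intro M
  obtain ⟨n, hn⟩ := exists_nat_ge (l * max N M / (2 * Real.pi))
  have hpi := Real.pi_pos
  -- At `u` and `v` the sine vanishes and the cosine is `1` and `-1`, so beyond `N` the term `x + y`
  -- fixes opposite signs.
  set u : ℝ := n * (2 * Real.pi) / l with hu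
  set v : ℝ := (n * (2 * Real.pi) + Real.pi) / l with hv
  have hlu : l * u = n * (2 * Real.pi) := by rw [hu]; field_simp
  have hlv : l * v = n * (2 * Real.pi) + Real.pi := by rw [hv]; field_simp
  have hu' : max N M ≤ u := by
    rw [div_le_iff₀ (by positivity)] at hn
    rw [hu, le_div_iff₀ hl]; linarith
  have huv : u ≤ v := by
    rw [hu, hv]; gcongr; linarith
  have hpos : 0 ≤ F u := by
    obtain ⟨s1, s2⟩ := hN u (le_trans (le_max_left _ _) hu')
    have := h u s2
    have hc : Real.cos (l * u) = 1 := by rw [hlu]; exact Real.cos_nat_mul_two_pi n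
    have hs : Real.sin (l * u) = 0 := by
      rw [hlu]; have := Real.sin_nat_mul_pi (2 * n); push_cast at this; rw [← this]; ring_nf
    simp only [hF, hc, hs]
    rw [eval_sub] at s1
    have b1 := neg_abs_le ((x.eval u - y.eval u) * Real.exp (-(l * u)) * Real.exp (-(l * u)))
    have b2 := neg_abs_le (r.eval u * Real.exp (-(l * u)))
    linarith
  have hneg : F v ≤ 0 := by
    obtain ⟨s1, s2⟩ := hN v (le_trans (le_max_left _ _) (hu'.trans huv))
    have := h v s2
    have hc : Real.cos (l * v) = -1 := by
      rw [hlv, Real.cos_add_pi, Real.cos_nat_mul_two_pi n]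
    have hs : Real.sin (l * v) = 0 := by
      rw [hlv, Real.sin_add_pi]
      have := Real.sin_nat_mul_pi (2 * n); push_cast at this; rw [neg_eq_zero, ← this]; ring_nf
    simp only [hF, hc, hs]
    rw [eval_sub] at s1
    have b1 := neg_abs_le ((x.eval v - y.eval v) * Real.exp (-(l * v)) * Real.exp (-(l * v)))
    have b2 := le_abs_self (r.eval v * Real.exp (-(l * v)))
    linarith
  obtain ⟨z, hz, hz0⟩ := intermediate_value_Icc' huv hcont.continuousOn ⟨hneg, hpos⟩
  exact ⟨z, (le_max_right N M).trans (hu'.trans hz.1), hz0⟩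

/-- Separation of the exponents `0` and `2` modulo `4`. -/
theorem eval_eq_zero_of_parity (p q : ℝ[X])
    (h : ∀ z : ℝ, 0 < z → p.eval (z ^ 4) + z ^ 2 * q.eval (z ^ 4) = 0) : p = 0 ∧ q = 0 := by
  -- As a polynomial identity in `w = z ^ 2` the relation extends to negative `w`, where the second
  -- term changes sign.
  have hpq : p.comp (X ^ 2) + X * q.comp (X ^ 2) = 0 := by
    refine Polynomial.eq_zero_of_infinite_isRoot _ ((Set.Ioi_infinite (0 : ℝ)).mono ?_)
    intro w hw
    have hw' : √w ^ 2 = w := Real.sq_sqrt (le_of_lt hw)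
    have := h (√w) (Real.sqrt_pos.2 hw)
    rw [show √w ^ 4 = (√w ^ 2) ^ 2 by ring, hw'] at this
    simpa using this
  have hval : ∀ w : ℝ, p.eval (w ^ 2) + w * q.eval (w ^ 2) = 0 := by
    intro w
    have := congrArg (eval w) hpq
    simpa using this
  have hzero : ∀ w : ℝ, 0 < w → p.eval w = 0 ∧ q.eval w = 0 := by
    intro w hw
    have hs : √w ^ 2 = w := Real.sq_sqrt hw.le
    have h1 := hval (√w)
    have h2 := hval (-√w)
    rw [neg_sq, hs] at h2
    rw [hs] at h1
    have h3 : √w * q.eval w = 0 := by linarith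
    exact ⟨by linarith, (mul_eq_zero.1 h3).resolve_left (Real.sqrt_pos.2 hw).ne'⟩
  exact ⟨Polynomial.eq_zero_of_infinite_isRoot _ ((Set.Ioi_infinite (0 : ℝ)).mono
      fun w hw => (hzero w hw).1),
    Polynomial.eq_zero_of_infinite_isRoot _ ((Set.Ioi_infinite (0 : ℝ)).mono
      fun w hw => (hzero w hw).2)⟩

/-! ### The explicit characteristic function -/

/-- The fundamental system of `y'''' = 0`. -/
noncomputable def FundamentalSystem.zero : FundamentalSystem 0 where
  K₀ _ := 1
  K₁ x := x
  K₂ x := x ^ 2 / 2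
  K₃ x := x ^ 3 / 6
  deriv₀ x := by simpa using hasDerivAt_const x (1 : ℂ)
  deriv₁ x := (hasDerivAt_id x).ofReal_comp.congr_deriv (by simp)
  deriv₂ x := (((hasDerivAt_id x).ofReal_comp.pow 2).div_const 2).congr_deriv (by simp)
  deriv₃ x := (((hasDerivAt_id x).ofReal_comp.pow 3).div_const 6).congr_deriv (by simp; ring)
  init₀ := rfl
  init₁ := by simp
  init₂ := by simp
  init₃ := by simp

/-- The fundamental system of `y'''' = z ^ 4 * y` for real `z ≠ 0`. -/
noncomputable def FundamentalSystem.ofReal (z : ℝ) (hz : z ≠ 0) :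
    FundamentalSystem ((z ^ 4 : ℝ) : ℂ) where
  K₀ x := (((Real.cosh (z * x) + Real.cos (z * x)) / 2 : ℝ) : ℂ)
  K₁ x := (((Real.sinh (z * x) + Real.sin (z * x)) / (2 * z) : ℝ) : ℂ)
  K₂ x := (((Real.cosh (z * x) - Real.cos (z * x)) / (2 * z ^ 2) : ℝ) : ℂ)
  K₃ x := (((Real.sinh (z * x) - Real.sin (z * x)) / (2 * z ^ 3) : ℝ) : ℂ)
  deriv₀ x := by
    have h := (hasDerivAt_id x).const_mul z
    have := ((h.cosh.add h.cos).div_const 2).ofReal_comp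
    refine this.congr_deriv ?_
    rw [← Complex.ofReal_mul]
    congr 1
    simp only [id]
    field_simp
    ring
  deriv₁ x := by
    have h := (hasDerivAt_id x).const_mul z
    have := ((h.sinh.add h.sin).div_const (2 * z)).ofReal_comp
    refine this.congr_deriv ?_
    congr 1
    simp only [id]
    field_simp
  deriv₂ x := by
    have h := (hasDerivAt_id x).const_mul z
    have := ((h.cosh.sub h.cos).div_const (2 * z ^ 2)).ofReal_comp
    refine this.congr_deriv ?_
    congr 1
    simp only [id]
    field_simp
    ring
  deriv₃ x := by
    have h := (hasDerivAt_id x).const_mul z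
    have := ((h.sinh.sub h.sin).div_const (2 * z ^ 3)).ofReal_comp
    refine this.congr_deriv ?_
    congr 1
    simp only [id]
    field_simp
  init₀ := by simp
  init₁ := by simp
  init₂ := by simp
  init₃ := by simp

namespace RodBC

/-- The coefficient of `cos * cosh + 1` as a polynomial in `z ^ 4`. -/
noncomputable def pE (a : RodBC) : ℝ[X] := C (a.e₁ * a.f₁) * X

/-- The coefficient of `cos * cosh - 1` as a polynomial in `z ^ 4`. -/
noncomputable def pD (a : RodBC) : ℝ[X] :=
  C (a.e₀ * a.f₀) * X ^ 2 + C a.m * X + C (a.e₂ * a.f₂)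

/-- The coefficient of `z * (cos * sinh - sin * cosh)` as a polynomial in `z ^ 4`. -/
noncomputable def pU (a : RodBC) : ℝ[X] := C (a.e₁ * a.f₀) * X + C (a.e₂ * a.f₁)

/-- The coefficient of `z ^ 3 * (cos * sinh + sin * cosh)` as a polynomial in `z ^ 4`. -/
noncomputable def pV (a : RodBC) : ℝ[X] := C (a.e₀ * a.f₁) * X + C (a.e₁ * a.f₂)

/-- The coefficient of `2 * z ^ 2 * sin * sinh` as a polynomial in `z ^ 4`. -/
noncomputable def pW (a : RodBC) : ℝ[X] := C (a.e₀ * a.f₂) * X - C (a.e₂ * a.f₀)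

/-- The coefficient of `cos * cosh` in the characteristic function. -/
noncomputable def coeffCosCosh (a : RodBC) : ℝ[X] := (a.pE + a.pD).comp (X ^ 4)

/-- The coefficient of `cos * sinh` in the characteristic function. -/
noncomputable def coeffCosSinh (a : RodBC) : ℝ[X] :=
  X * a.pU.comp (X ^ 4) + X ^ 3 * a.pV.comp (X ^ 4)

/-- The coefficient of `sin * cosh` in the characteristic function. -/
noncomputable def coeffSinCosh (a : RodBC) : ℝ[X] :=
  X ^ 3 * a.pV.comp (X ^ 4) - X * a.pU.comp (X ^ 4)

/-- The coefficient of `sin * sinh` in the characteristic function. -/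
noncomputable def coeffSinSinh (a : RodBC) : ℝ[X] :=
  2 * X ^ 2 * a.pW.comp (X ^ 4)

/-- The term of the characteristic function free of trigonometric functions. -/
noncomputable def coeffConst (a : RodBC) : ℝ[X] :=
  (a.pE - a.pD).comp (X ^ 4)

theorem ofReal_charDet (a₁ a₂ a₃ a₄ a₅ a₆ a₇ a₈ lam k₀ k₁ k₂ k₃ : ℝ) :
    ((charDet a₁ a₂ a₃ a₄ a₅ a₆ a₇ a₈ lam k₀ k₁ k₂ k₃ : ℝ) : ℂ) =
      charDet (a₁ : ℂ) a₂ a₃ a₄ a₅ a₆ a₇ a₈ lam k₀ k₁ k₂ k₃ := by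
  simp only [charDet]; push_cast; rfl

/-- The condition for `0` to be an eigenvalue. -/
theorem multiplicity_zero_ne_zero_iff (a : RodBC) (ha : a.Nondegenerate) {l : ℝ} (hl : 0 < l) :
    a.multiplicity l hl 0 ≠ 0 ↔ a.e₁ * a.f₁ + (l * (a.e₁ * a.f₂) - l ^ 3 / 3 * (a.e₂ * a.f₁) -
      l ^ 2 * (a.e₂ * a.f₀) - l ^ 4 / 12 * (a.e₂ * a.f₂)) = 0 := by
  rw [multiplicity_ne_zero_iff FundamentalSystem.zero a ha hl (by simp)]
  have h := ofReal_charDet a.a₁ a.a₂ a.a₃ a.a₄ a.a₅ a.a₆ a.a₇ a.a₈ 0 1 l (l ^ 2 / 2) (l ^ 3 / 6)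
  push_cast at h
  simp only [FundamentalSystem.zero]
  rw [← h, Complex.ofReal_eq_zero]
  refine Eq.congr ?_ rfl
  unfold charDet e₁ e₂ f₀ f₁ f₂
  ring

/-- The frequency equation for `s = z ^ 2`, `z > 0`. -/
theorem multiplicity_sq_ne_zero_iff (a : RodBC) (ha : a.Nondegenerate) {l : ℝ} (hl : 0 < l) {z : ℝ}
    (hz : 0 < z) :
    a.multiplicity l hl ((z ^ 2 : ℝ) : ℂ) ≠ 0 ↔
      (a.coeffCosCosh.eval z * (1 + Real.exp (-(l * z)) ^ 2) +
        a.coeffCosSinh.eval z * (1 - Real.exp (-(l * z)) ^ 2)) * Real.cos (l * z) +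
      (a.coeffSinCosh.eval z * (1 + Real.exp (-(l * z)) ^ 2) +
        a.coeffSinSinh.eval z * (1 - Real.exp (-(l * z)) ^ 2)) * Real.sin (l * z) +
      2 * Real.exp (-(l * z)) * a.coeffConst.eval z = 0 := by
  rw [multiplicity_ne_zero_iff (FundamentalSystem.ofReal z hz.ne') a ha hl (by push_cast; ring)]
  simp only [FundamentalSystem.ofReal]
  rw [← ofReal_charDet, Complex.ofReal_eq_zero, mul_comm z l]
  have hC := Real.cosh_sq' (l * z)
  have hs := Real.sin_sq_add_cos_sq (l * z)
  have hE : Real.exp (-(l * z)) * (Real.cosh (l * z) + Real.sinh (l * z)) = 1 := by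
    rw [Real.cosh_add_sinh, ← Real.exp_add]; simp
  have hE' : Real.cosh (l * z) - Real.sinh (l * z) = Real.exp (-(l * z)) := Real.cosh_sub_sinh _
  have hε := Real.exp_ne_zero (-(l * z))
  generalize Real.exp (-(l * z)) = ε at *
  generalize Real.cosh (l * z) = Ch at *
  generalize Real.sinh (l * z) = Sh at *
  generalize Real.cos (l * z) = c at *
  generalize Real.sin (l * z) = s at *
  have hz0 := hz.ne'
  have hC2 : 2 * ε * Ch = 1 + ε ^ 2 := by rw [← hE'] at hE ⊢; linear_combination hE
  have hS2 : 2 * ε * Sh = 1 - ε ^ 2 := by rw [← hE'] at hE ⊢; linear_combination hE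
  rw [← hC2, ← hS2]
  have key : 2 * z ^ 4 * charDet a.a₁ a.a₂ a.a₃ a.a₄ a.a₅ a.a₆ a.a₇ a.a₈ (z ^ 4) ((Ch + c) / 2)
      ((Sh + s) / (2 * z)) ((Ch - c) / (2 * z ^ 2)) ((Sh - s) / (2 * z ^ 3)) =
      (a.coeffCosCosh.eval z * Ch + a.coeffCosSinh.eval z * Sh) * c +
      (a.coeffSinCosh.eval z * Ch + a.coeffSinSinh.eval z * Sh) * s + a.coeffConst.eval z := by
    simp only [coeffCosCosh, coeffCosSinh, coeffSinCosh, coeffSinSinh, coeffConst, pE, pD, pU, pV,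
      pW, eval_comp, eval_add, eval_sub, eval_mul, eval_pow, eval_X, eval_C, eval_ofNat]
    unfold charDet e₀ e₁ e₂ f₀ f₁ f₂ m
    field_simp
    -- The squares in the determinant are removed with `cosh ^ 2 - sinh ^ 2 = 1 = sin ^ 2 + cos ^
    -- 2`.
    linear_combination (z ^ 4 * (a.a₃ * a.a₄ * a.a₅ * a.a₆ + a.a₁ * a.a₂ * a.a₇ * a.a₈) -
      z ^ 8 * (a.a₃ * a.a₄ * a.a₇ * a.a₈) - a.a₁ * a.a₂ * a.a₅ * a.a₆) * (hC + hs)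
  have hrhs : ∀ D x y t w r : ℝ, 2 * z ^ 4 * D = (x * Ch + y * Sh) * c + (t * Ch + w * Sh) * s + r →
      (D = 0 ↔ (x * (2 * ε * Ch) + y * (2 * ε * Sh)) * c +
        (t * (2 * ε * Ch) + w * (2 * ε * Sh)) * s + 2 * ε * r = 0) := by
    intro D x y t w r h
    have hne : 2 * ε * (2 * z ^ 4) ≠ 0 := by positivity
    rw [← mul_eq_zero_iff_left hne]
    refine Eq.congr ?_ rfl
    linear_combination 2 * ε * h
  exact hrhs _ _ _ _ _ _ key

/-! ### Sign properties and large eigenvalues -/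

theorem invariants_nonneg (a : RodBC) (ha : a.Nonneg) :
    0 ≤ a.e₀ ∧ 0 ≤ a.e₁ ∧ 0 ≤ a.e₂ ∧ 0 ≤ a.f₀ ∧ 0 ≤ a.f₁ ∧ 0 ≤ a.f₂ ∧ 0 ≤ a.m := by
  obtain ⟨p₁, p₂, p₃, p₄, p₅, p₆, p₇, p₈⟩ := ha
  unfold e₀ e₁ e₂ f₀ f₁ f₂ m
  refine ⟨?_, ?_, ?_, ?_, ?_, ?_, ?_⟩ <;> positivity

theorem products_ne_zero {p q r s : ℝ} (hp : 0 ≤ p) (hq : 0 ≤ q) (hr : 0 ≤ r) (hs : 0 ≤ s)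
    (h₁ : p ≠ 0 ∨ q ≠ 0) (h₂ : r ≠ 0 ∨ s ≠ 0) :
    (q * s ≠ 0 ∨ q * r + p * s ≠ 0 ∨ p * r ≠ 0) ∧
      (q * r + p * s = 0 → q * s = 0 ∨ p * r = 0) := by
  have hqr := mul_nonneg hq hr
  have hps := mul_nonneg hp hs
  rw [Ne, Ne, Ne, add_eq_zero_iff_of_nonneg hqr hps]
  simp only [mul_eq_zero]
  tauto

theorem invariants_ne_zero (a : RodBC) (ha : a.Nonneg) (ha' : a.Nondegenerate) :
    ((a.e₀ ≠ 0 ∨ a.e₁ ≠ 0 ∨ a.e₂ ≠ 0) ∧ (a.e₁ = 0 → a.e₀ = 0 ∨ a.e₂ = 0)) ∧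
      (a.f₀ ≠ 0 ∨ a.f₁ ≠ 0 ∨ a.f₂ ≠ 0) ∧ (a.f₁ = 0 → a.f₀ = 0 ∨ a.f₂ = 0) := by
  obtain ⟨p₁, p₂, p₃, p₄, p₅, p₆, p₇, p₈⟩ := ha
  obtain ⟨n₁, n₂, n₃, n₄⟩ := ha'
  exact ⟨products_ne_zero p₁ p₄ p₅ p₈ n₁ n₃, products_ne_zero p₂ p₃ p₆ p₇ n₂ n₄⟩

/-- `m` is one of two nonnegative parts whose sum is `e₁ f₁`. -/
theorem m_eq_zero (a : RodBC) (ha : a.Nonneg) (h : a.e₁ * a.f₁ = 0) : a.m = 0 := by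
  have h0 := (a.invariants_nonneg ha).2.2.2.2.2.2
  obtain ⟨p₁, p₂, p₃, p₄, p₅, p₆, p₇, p₈⟩ := ha
  have h1 : 0 ≤ a.a₃ * a.a₄ * a.a₅ * a.a₆ + a.a₁ * a.a₂ * a.a₇ * a.a₈ := by positivity
  unfold e₁ f₁ at h
  unfold m at *
  linarith

/-- There are arbitrarily large eigenvalues. -/
theorem frequently_multiplicity_ne_zero (a : RodBC) (ha : a.Nonneg) (ha' : a.Nondegenerate) {l : ℝ}
    (hl : 0 < l) : ∃ᶠ z : ℝ in atTop, a.multiplicity l hl ((z ^ 2 : ℝ) : ℂ) ≠ 0 := by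
  obtain ⟨q₀, q₁, q₂, r₀, r₁, r₂, hm⟩ := a.invariants_nonneg ha
  have h00 := mul_nonneg q₀ r₀
  have h01 := mul_nonneg q₀ r₁
  have h10 := mul_nonneg q₁ r₀
  have h11 := mul_nonneg q₁ r₁
  have h12 := mul_nonneg q₁ r₂
  have h21 := mul_nonneg q₂ r₁
  have h22 := mul_nonneg q₂ r₂
  suffices h : ∃ᶠ z : ℝ in atTop,
      (a.coeffCosCosh.eval z * (1 + Real.exp (-(l * z)) ^ 2) +
        a.coeffCosSinh.eval z * (1 - Real.exp (-(l * z)) ^ 2)) * Real.cos (l * z) +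
      (a.coeffSinCosh.eval z * (1 + Real.exp (-(l * z)) ^ 2) +
        a.coeffSinSinh.eval z * (1 - Real.exp (-(l * z)) ^ 2)) * Real.sin (l * z) +
      2 * Real.exp (-(l * z)) * a.coeffConst.eval z = 0 by
    refine (h.and_eventually (eventually_gt_atTop 0)).mono ?_
    rintro z ⟨h, hz⟩
    exact (a.multiplicity_sq_ne_zero_iff ha' hl hz).2 h
  -- For `z ≥ 1` every power of `z` is at least `1`, so this sum bounds the leading cosine
  -- coefficient below. If it is zero, only the `sin sinh` term remains, with roots `l z = n π`.
  by_cases hS : 0 < a.e₁ * a.f₁ + a.e₀ * a.f₀ + a.m + a.e₂ * a.f₂ + a.e₁ * a.f₀ + a.e₂ * a.f₁ +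
      a.e₀ * a.f₁ + a.e₁ * a.f₂
  · refine frequently_frequency_equation hl _ _ _ _ _ hS fun z hz => ?_
    have hz4 : 1 ≤ z ^ 4 := one_le_pow₀ hz
    have hz3 : 1 ≤ z ^ 3 := one_le_pow₀ hz
    have hz8 : 1 ≤ (z ^ 4) ^ 2 := one_le_pow₀ hz4
    have hz5 : 1 ≤ z * z ^ 4 := one_le_mul_of_one_le_of_one_le hz hz4
    have hz7 : 1 ≤ z ^ 3 * z ^ 4 := one_le_mul_of_one_le_of_one_le hz3 hz4
    simp only [coeffCosCosh, coeffCosSinh, pE, pD, pU, pV, eval_comp, eval_add, eval_mul, eval_pow,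
      eval_X, eval_C]
    have b1 := le_mul_of_one_le_right h11 hz4
    have b2 := le_mul_of_one_le_right h00 hz8
    have b3 := le_mul_of_one_le_right hm hz4
    have b4 := le_mul_of_one_le_right h10 hz5
    have b5 := le_mul_of_one_le_right h21 hz
    have b6 := le_mul_of_one_le_right h01 hz7
    have b7 := le_mul_of_one_le_right h12 hz3
    linarith
  · have e11 : a.e₁ * a.f₁ = 0 := by linarith
    have e00 : a.e₀ * a.f₀ = 0 := by linarith
    have em : a.m = 0 := by linarith
    have e22 : a.e₂ * a.f₂ = 0 := by linarith
    have e10 : a.e₁ * a.f₀ = 0 := by linarith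
    have e21 : a.e₂ * a.f₁ = 0 := by linarith
    have e01 : a.e₀ * a.f₁ = 0 := by linarith
    have e12 : a.e₁ * a.f₂ = 0 := by linarith
    rw [frequently_atTop]
    intro M
    obtain ⟨n, hn⟩ := exists_nat_ge (l * M / Real.pi)
    have hpi := Real.pi_pos
    refine ⟨n * Real.pi / l, ?_, ?_⟩
    · rw [div_le_iff₀ hpi] at hn
      rw [le_div_iff₀ hl]; linarith
    · have hs : Real.sin (l * (n * Real.pi / l)) = 0 := by
        rw [mul_div_cancel₀ _ hl.ne']; exact Real.sin_nat_mul_pi n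
      rw [hs]
      simp [coeffCosCosh, coeffCosSinh, coeffConst, pE, pD, pU, pV, e11, e00, em, e22, e10, e21, e01,
        e12]

/-! ### Isospectral problems and the conclusion -/

/-- The coefficients of the characteristic functions of isospectral problems are proportional. -/
theorem coefficients_proportional (a b : RodBC) (ha : a.Nonneg) (ha' : a.Nondegenerate)
    (hb' : b.Nondegenerate) {l : ℝ} (hl : 0 < l)
    (hspec : ∀ s : ℂ, a.multiplicity l hl s = b.multiplicity l hl s) :
    a.pE * b.pD = b.pE * a.pD ∧ a.pE * b.pU = b.pE * a.pU ∧ a.pE * b.pV = b.pE * a.pV ∧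
    a.pE * b.pW = b.pE * a.pW ∧ a.pD * b.pU = b.pD * a.pU ∧ a.pD * b.pV = b.pD * a.pV ∧
    a.pD * b.pW = b.pD * a.pW ∧ a.pU * b.pV = b.pU * a.pV ∧ a.pU * b.pW = b.pU * a.pW ∧
    a.pV * b.pW = b.pV * a.pW := by
  have hfreq : ∃ᶠ z : ℝ in atTop, ∃ c s ε : ℝ, c ^ 2 + s ^ 2 = 1 ∧
      ε ^ 2 = Real.exp (-((2 * l) * z)) ∧
      (a.coeffCosCosh.eval z * (1 + ε ^ 2) + a.coeffCosSinh.eval z * (1 - ε ^ 2)) * c +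
        (a.coeffSinCosh.eval z * (1 + ε ^ 2) + a.coeffSinSinh.eval z * (1 - ε ^ 2)) * s +
        2 * ε * a.coeffConst.eval z = 0 ∧
      (b.coeffCosCosh.eval z * (1 + ε ^ 2) + b.coeffCosSinh.eval z * (1 - ε ^ 2)) * c +
        (b.coeffSinCosh.eval z * (1 + ε ^ 2) + b.coeffSinSinh.eval z * (1 - ε ^ 2)) * s +
        2 * ε * b.coeffConst.eval z = 0 := by
    refine ((a.frequently_multiplicity_ne_zero ha ha' hl).and_eventually
      (eventually_gt_atTop 0)).mono ?_
    rintro z ⟨hz, hz0⟩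
    refine ⟨Real.cos (l * z), Real.sin (l * z), Real.exp (-(l * z)),
      Real.cos_sq_add_sin_sq _, ?_, (a.multiplicity_sq_ne_zero_iff ha' hl hz0).1 hz,
      (b.multiplicity_sq_ne_zero_iff hb' hl hz0).1 (hspec _ ▸ hz)⟩
    rw [← Real.exp_nat_mul]
    congr 1
    push_cast
    ring
  -- With `ε = exp (-l z)` the eliminated relation involves only `ε ^ 2`, hence `2 * l`.
  have hel := frequency_equation_elimination (by positivity : 0 < 2 * l) _ _ _ _ _ _ _ _ _ _ hfreq
  simp only [coeffCosCosh, coeffCosSinh, coeffSinCosh, coeffSinSinh, coeffConst, eval_comp, eval_add,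
    eval_sub, eval_mul, eval_pow, eval_X, eval_ofNat] at hel
  obtain ⟨hED, -⟩ := eval_eq_zero_of_parity (a.pE * b.pD - b.pE * a.pD) 0 fun z hz => by
    obtain ⟨h, -⟩ := hel z
    simp only [eval_sub, eval_mul, eval_zero]
    linear_combination h / 2
  obtain ⟨hRU, hRV⟩ := eval_eq_zero_of_parity ((a.pE - a.pD) * b.pU - (b.pE - b.pD) * a.pU)
      ((a.pE - a.pD) * b.pV - (b.pE - b.pD) * a.pV) fun z hz => by
    obtain ⟨-, h, -⟩ := hel z
    simp only [eval_sub, eval_mul]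
    apply mul_left_cancel₀ hz.ne'
    linear_combination h
  obtain ⟨hRW, -⟩ := eval_eq_zero_of_parity ((a.pE - a.pD) * b.pW - (b.pE - b.pD) * a.pW) 0
      fun z hz => by
    obtain ⟨-, -, -, h, -⟩ := hel z
    simp only [eval_sub, eval_mul, eval_zero]
    apply mul_left_cancel₀ (pow_ne_zero 2 hz.ne')
    linear_combination h / 2
  obtain ⟨hXU, hXV⟩ := eval_eq_zero_of_parity (-((a.pE + a.pD) * b.pU - (b.pE + b.pD) * a.pU))
      ((a.pE + a.pD) * b.pV - (b.pE + b.pD) * a.pV) fun z hz => by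
    obtain ⟨-, -, -, -, h, -⟩ := hel z
    simp only [eval_sub, eval_mul, eval_neg, eval_add]
    apply mul_left_cancel₀ hz.ne'
    linear_combination h
  obtain ⟨hUW, hVW⟩ := eval_eq_zero_of_parity (a.pU * b.pW - b.pU * a.pW)
      (a.pV * b.pW - b.pV * a.pW) fun z hz => by
    obtain ⟨-, -, -, -, -, h, -⟩ := hel z
    simp only [eval_sub, eval_mul]
    apply mul_left_cancel₀ (pow_ne_zero 3 hz.ne')
    linear_combination h / 2
  obtain ⟨hXW, hUV⟩ := eval_eq_zero_of_parity ((a.pE + a.pD) * b.pW - (b.pE + b.pD) * a.pW)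
      (a.pU * b.pV - b.pU * a.pV) fun z hz => by
    obtain ⟨-, -, -, -, -, -, h⟩ := hel z
    simp only [eval_sub, eval_mul, eval_add]
    apply mul_left_cancel₀ (pow_ne_zero 2 hz.ne')
    linear_combination h / 2
  -- The relations obtained so far concern `pE + pD` and `pE - pD`; sums and differences give twice
  -- those for `pE` and `pD`.
  have half : ∀ {p : ℝ[X]}, 2 * p = 0 → p = 0 := fun {p} h => by simpa using h
  refine ⟨sub_eq_zero.1 hED, sub_eq_zero.1 (half ?_), sub_eq_zero.1 (half ?_),
    sub_eq_zero.1 (half ?_), sub_eq_zero.1 (half ?_), sub_eq_zero.1 (half ?_),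
    sub_eq_zero.1 (half ?_), sub_eq_zero.1 hUV, sub_eq_zero.1 hUW, sub_eq_zero.1 hVW⟩
  · linear_combination hRU - hXU
  · linear_combination hRV + hXV
  · linear_combination hRW + hXW
  · linear_combination -hRU - hXU
  · linear_combination -hRV + hXV
  · linear_combination -hRW + hXW

end RodBC

theorem theorem1 (l : ℝ) (hl : 0 < l) (a b : RodBC)
    (ha : a.Nonneg) (hb : b.Nonneg)
    (hrank_a : a.matrix.rank = 4) (hrank_b : b.matrix.rank = 4)
    (hspec : ∀ s : ℂ, a.multiplicity l hl s = b.multiplicity l hl s) :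
    LinearlyEquivalent a.matrix b.matrix ∨ LinearlyEquivalent a.matrix b.swap.matrix := by
  have ha' := a.nondegenerate_of_rank hrank_a
  have hb' := b.nondegenerate_of_rank hrank_b
  obtain ⟨hED, hEU, hEV, hEW, hDU, hDV, hDW, hUV, hUW, hVW⟩ :=
    a.coefficients_proportional b ha ha' hb' hl hspec
  have hΔ := a.multiplicity_zero_ne_zero_iff ha' hl
  rw [hspec 0, b.multiplicity_zero_ne_zero_iff hb' hl] at hΔ
  obtain ⟨-, -, -, qf₀, qf₁, qf₂, -⟩ := a.invariants_nonneg ha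
  obtain ⟨-, -, -, qh₀, qh₁, qh₂, -⟩ := b.invariants_nonneg hb
  obtain ⟨⟨he, he'⟩, hf, hf'⟩ := a.invariants_ne_zero ha ha'
  obtain ⟨⟨hg, hg'⟩, hh, hh'⟩ := b.invariants_ne_zero hb hb'
  have ev : ∀ {p q r s : ℝ[X]}, p * q = r * s → ∀ t : ℝ, p.eval t * q.eval t = r.eval t * s.eval t :=
    fun h t => by rw [← eval_mul, h, eval_mul]
  replace hED := ev hED
  replace hEU := ev hEU
  replace hEV := ev hEV
  replace hEW := ev hEW
  replace hDU := ev hDU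
  replace hDV := ev hDV
  replace hDW := ev hDW
  replace hUV := ev hUV
  replace hUW := ev hUW
  replace hVW := ev hVW
  simp only [RodBC.pE, RodBC.pD, RodBC.pU, RodBC.pV, RodBC.pW, eval_add, eval_sub, eval_mul,
    eval_pow, eval_X, eval_C] at hED hEU hEV hEW hDU hDV hDW hUV hUW hVW
  obtain ⟨h00, hm, h22, -⟩ := cubic_coeffs_eq_zero
    (a.e₁ * a.f₁ * (b.e₀ * b.f₀) - b.e₁ * b.f₁ * (a.e₀ * a.f₀))
    (a.e₁ * a.f₁ * b.m - b.e₁ * b.f₁ * a.m)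
    (a.e₁ * a.f₁ * (b.e₂ * b.f₂) - b.e₁ * b.f₁ * (a.e₂ * a.f₂)) 0
    fun t => by linear_combination hED t
  obtain ⟨-, h10, h21, -⟩ := cubic_coeffs_eq_zero 0
    (a.e₁ * a.f₁ * (b.e₁ * b.f₀) - b.e₁ * b.f₁ * (a.e₁ * a.f₀))
    (a.e₁ * a.f₁ * (b.e₂ * b.f₁) - b.e₁ * b.f₁ * (a.e₂ * a.f₁)) 0
    fun t => by linear_combination hEU t
  obtain ⟨-, h01, h12, -⟩ := cubic_coeffs_eq_zero 0
    (a.e₁ * a.f₁ * (b.e₀ * b.f₁) - b.e₁ * b.f₁ * (a.e₀ * a.f₁))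
    (a.e₁ * a.f₁ * (b.e₁ * b.f₂) - b.e₁ * b.f₁ * (a.e₁ * a.f₂)) 0
    fun t => by linear_combination hEV t
  obtain ⟨-, h02, h20, -⟩ := cubic_coeffs_eq_zero 0
    (a.e₁ * a.f₁ * (b.e₀ * b.f₂) - b.e₁ * b.f₁ * (a.e₀ * a.f₂))
    (-(a.e₁ * a.f₁ * (b.e₂ * b.f₀)) + b.e₁ * b.f₁ * (a.e₂ * a.f₀)) 0
    fun t => by linear_combination hEW t
  suffices hcross : (a.e₀ * b.e₁ = a.e₁ * b.e₀ ∧ a.e₀ * b.e₂ = a.e₂ * b.e₀ ∧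
      a.e₁ * b.e₂ = a.e₂ * b.e₁) ∧ (a.f₀ * b.f₁ = a.f₁ * b.f₀ ∧ a.f₀ * b.f₂ = a.f₂ * b.f₀ ∧
      a.f₁ * b.f₂ = a.f₂ * b.f₁) by
    obtain ⟨⟨c₁, c₂, c₃⟩, c₄, c₅, c₆⟩ := hcross
    exact a.linearlyEquivalent_of_invariants b hb ha' hb' c₁ c₂ c₃ c₄ c₅ c₆
      (by linear_combination -hm)
  by_cases hef : a.e₁ * a.f₁ = 0
  -- If only one of the mixed products vanished, all products `eᵢ fⱼ` of `a` would be zero.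
  · have hgh : b.e₁ * b.f₁ = 0 := by
      by_contra hgh
      rw [hef, zero_mul, zero_sub, neg_eq_zero, mul_eq_zero_iff_left hgh] at h00 h22 h10 h21
      rw [hef, zero_mul, zero_sub, neg_eq_zero, mul_eq_zero_iff_left hgh] at h01 h12 h02
      rw [hef, zero_mul, neg_zero, zero_add, mul_eq_zero_iff_left hgh] at h20
      simp only [mul_eq_zero] at h00 h22 h10 h21 h01 h12 h02 h20 hef
      grind
    have ma := a.m_eq_zero ha hef
    have mb := b.m_eq_zero hb hgh
    rw [hef, hgh, zero_add, zero_add] at hΔ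
    rw [ma, mb] at hDU hDV hDW
    refine cross_of_eq_zero hl qf₀ qf₁ qf₂ qh₀ qh₁ qh₂ he hf hg hh he' hf' hg' hh' hef hgh hΔ.symm
      ?_ ?_ ?_ ?_ ?_ ?_ <;> intro t
    · linear_combination hDU t
    · linear_combination hDV t
    · linear_combination hDW t
    · linear_combination hUV t
    · linear_combination hUW t
    · linear_combination hVW t
  · exact cross_of_ne_zero hg hh hef (sub_eq_zero.1 h00) (sub_eq_zero.1 h22) (sub_eq_zero.1 h10)
      (sub_eq_zero.1 h21) (sub_eq_zero.1 h01) (sub_eq_zero.1 h12) (sub_eq_zero.1 h02)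
      (by linear_combination -h20)
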